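/- Let $\kappa$ be a regular uncountable cardinal with $\kappa^{<\kappa}=\kappa$, and let $\operatorname{reg}\kappa$ be the set of infinite regular cardinals below $\kappa$. **Stationarity.** For $\mu\in\operatorname{reg}\kappa$ let $S^\kappa_\mu=\{\alpha<\kappa:\operatorname{cf}\alpha=\mu\}$, and let $S^\kappa_{\ge\mu}$, $S^\kappa_{\le\mu}$ be the unions of the $S^\kappa_\nu$ over $\nu\in\operatorname{reg}\kappa$ with $\nu\ge\mu$, resp. $\nu\le\mu$. A set $C\subset\kappa$ is $\mu$-closed if it contains the supremum of every increasing sequence of length $\mu$ of its elements, closed if it is $\mu$-closed for all $\mu\in\operatorname{reg}\kappa$, and $\mu$-cub (cub) if it is $\mu$-closed (closed) and unbounded in $\kappa$. A set is $\mu$-stationary (stationary) if it meets every $\mu$-cub (cub) set. **Game.** For $A\subset\kappa$ and $\lambda\in\operatorname{reg}\kappa$, the game $\mathrm{GC}_\lambda(A)$ has $\lambda$ moves. At move $i$ player I picks $\alpha_i<\kappa$ greater than all ordinals picked earlier, and then player II picks $\beta_i$ with $\alpha_i<\beta_i<\kappa$; II wins if $\sup_{i<\lambda}\alpha_i\in A$.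 The $\mathrm{GC}_\lambda$-characterization holds for $\kappa$ if for all $A\subset\kappa$, II has a winning strategy in $\mathrm{GC}_\lambda(A)$ if and only if $A$ contains a $\lambda$-cub set. **Spaces.** The space $2^\kappa$ has the topology generated by the sets $N_p=\{\eta\in 2^\kappa:\eta\restriction\alpha=p\}$ with $\alpha<\kappa$, $p\in2^\alpha$, and $(2^\kappa)^2$ has the product topology; for $r=(r_1,r_2)$ with $r_1,r_2\in 2^{<\kappa}$ put $N_r=N_{r_1}\times N_{r_2}$. Borel sets are obtained by closing the topology under complements and under unions and intersections of length $\le\kappa$; a function is Borel if inverse images of open sets are Borel; $E\le_B E'$ means that there is a Borel $f$ with $\eta E\xi\iff f(\eta)E'f(\xi)$ for all $\eta,\xi$. A co-meager subset of a space is one containing an intersection of at most $\kappa$ dense open subsets of it. If $E,E'$ are relations on spaces $X,Y$ and $C\subset X$, a continuous reduction of $E$ to $E'$ on $C$ is a continuous $f:C\to Y$ such that $(\eta,\xi)\in E\iff(f(\eta),f(\xi))\in E'$ for all $\eta,\xi\in C$. **Relations.** For a set $S$ of limit ordinals below $\kappa$, $E_S$ is the relation on $2^\kappa$ in which $\eta,\xi$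 are equivalent if and only if $\{\gamma:\eta(\gamma)\ne\xi(\gamma)\}$ is bounded in $\kappa$ and for every $\alpha\in S$ there is $\beta<\alpha$ such that either $\eta(\gamma)=\xi(\gamma)$ for all $\gamma\in(\beta,\alpha)$ or $\eta(\gamma)\neq\xi(\gamma)$ for all $\gamma\in(\beta,\alpha)$. On $(2^\kappa)^2$, $E\otimes E'$ is the coordinatewise product relation. **Square.** Assume that $\kappa$ is a successor cardinal and $\mu\in\operatorname{reg}\kappa$, $\mu>\omega$. A $\square^\kappa_\mu$-sequence is a sequence $\langle C_\alpha:\alpha\in S^\kappa_{\le\mu}\rangle$ such that for all such $\alpha$: $C_\alpha$ is a closed unbounded subset of $\alpha$; if $\beta\in\lim C_\alpha$ (the set of limit points of $C_\alpha$ below $\alpha$), then $\beta\in S^\kappa_{\le\mu}$ and $C_\beta=\beta\cap C_\alpha$; and if $\operatorname{cf}\alpha<\mu$ then $|C_\alpha|<\mu$. $\square^\kappa_\mu$ says that such a sequence exists. **Theorem.** Assume that $\lambda\in\operatorname{reg}\kappa$ and that the $\mathrm{GC}_\lambda$-characterization holds for $\kappa$. 1. Suppose that $S_1,S_2\subset S^\kappa_{\ge\lambda}$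 and $(S_2\setminus S_1)\cap S^\kappa_\lambda$ is stationary. Then (a) $E_{S_1}\not\le_B E_{S_2}$; (b) if $p\in2^{<\kappa}$ and $C\subset N_p$ is co-meager in $N_p$, there is no continuous reduction of $E_{S_1}$ to $E_{S_2}$ on $C$. 2. Suppose that $\kappa$ is a successor cardinal, $\kappa>\omega_1$, $\mu\in\operatorname{reg}\kappa\setminus\{\omega\}$ and $\square^\kappa_\mu$ holds, and let $\langle C_\alpha:\alpha\in S^\kappa_{\le\mu}\rangle$ be a $\square^\kappa_\mu$-sequence. Let $S\subset S^\kappa_\omega$ be stationary and let $B_{\mathrm{nr}}\subset S$ be such that $\lim C_\alpha\subset\alpha\setminus B_{\mathrm{nr}}$ for all $\alpha\in S^\kappa_{\le\mu}\cap S^\kappa_{\ge\omega_1}$ (so that $B_{\mathrm{nr}}$ reflects to no such $\alpha$). Let $S_1,S_2\subset S^\kappa_\mu$, $B\subset B_{\mathrm{nr}}$, $S_1'=S_1\cup B$, $S_2'=S_2\cup B$, and suppose that $(S_2'\setminus S_1')\cap S^\kappa_\mu$ is stationary. Then (a) $E_{S_1'}\not\le_B E_{S_2'}$; (b) if $p\in2^{<\kappa}$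 and $C\subset N_p$ is co-meager in $N_p$, there is no continuous reduction of $E_{S_1'}$ to $E_{S_2'}$ on $C$. 3. Let $S_1,S_2,A_1,A_2\subset S^\kappa_\omega$ be such that either $S_2\setminus S_1$ and $A_2\setminus S_1$ are both stationary, or $S_2\setminus A_1$ and $A_2\setminus A_1$ are both stationary. Then (a) $E_{S_1}\otimes E_{A_1}\not\le_B E_{S_2}\otimes E_{A_2}$; (b) if $\alpha<\kappa$, $r\in(2^\alpha)^2$ and $C\subset(2^\kappa)^2$ is such that $C\cap N_r$ is co-meager in $N_r$, there is no continuous reduction of $E_{S_1}\otimes E_{A_1}$ to $E_{S_2}\otimes E_{A_2}$ on $C\cap N_r$. 4. Let $S_1,S_2,A_2$ be sets of limit ordinals below $\kappa$ such that $A_2\setminus S_1$ and $S_2\setminus S_1$ are $\omega$-stationary. Then (a) $E_{S_1}\not\le_B E_{S_2}\otimes E_{A_2}$; (b) if $p\in2^{<\kappa}$ and $C\subset N_p$ is co-meager in $N_p$, there is no continuous reduction of $E_{S_1}$ to $E_{S_2}\otimes E_{A_2}$ on $C$. 5. Let $S_1,A_1,S_2,A_2$ be sets of limit ordinals below $\kappa$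 such that $A_2\setminus A_1$ is $\omega$-stationary. Then (a) $E_{S_1}\otimes E_{A_1}\not\le_B E_{S_2\cup A_2}$; (b) if $p\in(2^{<\kappa})^2$ and $C\subset N_p$ is co-meager in $N_p$, there is no continuous reduction of $E_{S_1}\otimes E_{A_1}$ to $E_{S_2\cup A_2}$ on $C$. -/

import Mathlib

open Cardinal Ordinal Set

universe u v w

namespace CubGames

/-! ### Subsets of a cardinal

Subsets of `κ` are sets of ordinals contained in `Iio κ.ord`. -/

/-- `reg κ`: the infinite regular cardinals below `κ`. -/
def reg (κ : Cardinal.{u}) : Set Cardinal.{u} := {μ | μ.IsRegular ∧ μ < κ}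

/-- The limit ordinals below `κ` (zero is not a limit ordinal). -/
def limits (κ : Cardinal.{u}) : Set Ordinal.{u} := {α | α < κ.ord ∧ Order.IsSuccLimit α}

/-- `S^κ_μ`: the ordinals below `κ` of cofinality `μ`. -/
def cofEq (κ μ : Cardinal.{u}) : Set Ordinal.{u} := {α | α < κ.ord ∧ α.cof = μ}

/-- `S^κ_{≥ μ}`: the union of the `S^κ_ν` over `ν ∈ reg κ` with `μ ≤ ν`. -/
def cofGe (κ μ : Cardinal.{u}) : Set Ordinal.{u} := ⋃ ν ∈ {ν ∈ reg κ | μ ≤ ν}, cofEq κ ν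

/-- `S^κ_{≤ μ}`: the union of the `S^κ_ν` over `ν ∈ reg κ` with `ν ≤ μ`. -/
def cofLe (κ μ : Cardinal.{u}) : Set Ordinal.{u} := ⋃ ν ∈ {ν ∈ reg κ | ν ≤ μ}, cofEq κ ν

/-- `C` is unbounded in the ordinal `δ`. -/
def UnboundedIn (δ : Ordinal.{u}) (C : Set Ordinal.{u}) : Prop :=
  ∀ α < δ, ∃ β ∈ C, α < β ∧ β < δ

/-- `C` contains the supremum of each increasing sequence of length `lam` of its elements. -/
def LamClosed (lam : Cardinal.{u}) (C : Set Ordinal.{u}) : Prop :=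
  ∀ s : Iio lam.ord → Ordinal.{u}, StrictMono s → (∀ i, s i ∈ C) → (⨆ i, s i) ∈ C

/-- `C ⊆ κ` is `lam`-closed and unbounded. -/
def IsLamCub (κ lam : Cardinal.{u}) (C : Set Ordinal.{u}) : Prop :=
  C ⊆ Iio κ.ord ∧ LamClosed lam C ∧ UnboundedIn κ.ord C

/-- `C ⊆ κ` is closed (`lam`-closed for all regular `lam < κ`) and unbounded. -/
def IsCub (κ : Cardinal.{u}) (C : Set Ordinal.{u}) : Prop :=
  C ⊆ Iio κ.ord ∧ (∀ lam ∈ reg κ, LamClosed lam C) ∧ UnboundedIn κ.ord C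

/-- `S` meets every `lam`-cub subset of `κ`. -/
def LamStationary (κ lam : Cardinal.{u}) (S : Set Ordinal.{u}) : Prop :=
  ∀ C, IsLamCub κ lam C → (S ∩ C).Nonempty

/-- `S` meets every cub subset of `κ`. -/
def Stationary (κ : Cardinal.{u}) (S : Set Ordinal.{u}) : Prop :=
  ∀ C, IsCub κ C → (S ∩ C).Nonempty

/-! ### The cub-game -/

/-- A strategy of player II: it computes the reply `β_i` from player I's moves `(α_j)_{j ≤ i}`
(player II's own earlier moves are determined by these). -/
def StrategyII (κ : Cardinal.{u}) : Type (u + 1) :=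
  (i : Ordinal.{u}) → (Iic i → Iio κ.ord) → Iio κ.ord

/-- The reply `β_i` of the strategy `σ` in the run where player I plays `a`. -/
def StrategyII.reply {κ lam : Cardinal.{u}} (σ : StrategyII κ)
    (a : Iio lam.ord → Iio κ.ord) (i : Iio lam.ord) : Iio κ.ord :=
  σ i.1 fun j => a ⟨j.1, lt_of_le_of_lt (mem_Iic.1 j.2) (mem_Iio.1 i.2)⟩

/-- `σ` is a winning strategy of player II in `GC_lam(A)`: whenever player I follows the rules
for `lam` moves (each move exceeds all ordinals picked before by either player), the replies
are legal (`β_i > α_i`) and the supremum of player I's moves belongs to `A`. -/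
def StrategyII.Wins {κ : Cardinal.{u}} (lam : Cardinal.{u}) (A : Set Ordinal.{u})
    (σ : StrategyII κ) : Prop :=
  ∀ a : Iio lam.ord → Iio κ.ord,
    (∀ i j, j < i → a j < a i ∧ σ.reply a j < a i) →
    (∀ i, a i < σ.reply a i) ∧ (⨆ i, (a i : Ordinal.{u})) ∈ A

/-- The `GC_lam`-characterization holds for `κ`. -/
def GCCharacterization (κ lam : Cardinal.{u}) : Prop :=
  ∀ A ⊆ Iio κ.ord, (∃ σ : StrategyII κ, σ.Wins lam A) ↔ ∃ C ⊆ A, IsLamCub κ lam C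

/-! ### The generalized Cantor space -/

/-- The space `2^κ`; a type synonym, since its topology is not the product topology. -/
def Cantor (κ : Cardinal.{u}) : Type (u + 1) := Iio κ.ord → Bool

/-- The basic set `N_p = {η | η ↾ α = p}` for `p ∈ 2^α`. -/
def cyl (κ : Cardinal.{u}) {α : Ordinal.{u}} (p : Iio α → Bool) : Set (Cantor κ) :=
  {η | ∀ (γ : Iio κ.ord) (h : γ.1 < α), η γ = p ⟨γ.1, h⟩}

instance (κ : Cardinal.{u}) : TopologicalSpace (Cantor κ) :=
  TopologicalSpace.generateFrom
    {U | ∃ α < κ.ord, ∃ p : Iio α → Bool, U = cyl κ p}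

/-- The `κ`-Borel sets: the closure of the topology under complements and under unions and
intersections of length at most `κ`. -/
inductive IsBorel (κ : Cardinal.{u}) {X : Type v} [TopologicalSpace X] : Set X → Prop
  | of_isOpen {U : Set X} (hU : IsOpen U) : IsBorel κ U
  | compl {A : Set X} (hA : IsBorel κ A) : IsBorel κ Aᶜ
  | iUnion {o : Ordinal.{u}} (ho : o ≤ κ.ord) (A : Iio o → Set X)
      (hA : ∀ i, IsBorel κ (A i)) : IsBorel κ (⋃ i, A i)
  | iInter {o : Ordinal.{u}} (ho : o ≤ κ.ord) (A : Iio o → Set X)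
      (hA : ∀ i, IsBorel κ (A i)) : IsBorel κ (⋂ i, A i)

/-- Inverse images of open sets are `κ`-Borel. -/
def BorelFun (κ : Cardinal.{u}) {X : Type v} {Y : Type w} [TopologicalSpace X]
    [TopologicalSpace Y] (f : X → Y) : Prop :=
  ∀ U : Set Y, IsOpen U → IsBorel κ (f ⁻¹' U)

/-- `E` is Borel reducible to `E'`. -/
def BorelReducible (κ : Cardinal.{u}) {X : Type v} {Y : Type w} [TopologicalSpace X]
    [TopologicalSpace Y] (E : X → X → Prop) (E' : Y → Y → Prop) : Prop :=
  ∃ f : X → Y, BorelFun κ f ∧ ∀ η ξ, E η ξ ↔ E' (f η) (f ξ)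

/-- A continuous function `C → Y` (for the subspace topology on `C`) reduces `E` restricted
to `C` to `E'`. -/
def ContinuouslyReducibleOn {X : Type v} {Y : Type w} [TopologicalSpace X]
    [TopologicalSpace Y] (C : Set X) (E : X → X → Prop) (E' : Y → Y → Prop) : Prop :=
  ∃ f : C → Y, Continuous f ∧ ∀ η ξ : C, E η ξ ↔ E' (f η) (f ξ)

/-- `D` contains an intersection of at most `κ` dense open subsets of the space `X`. -/
def Comeager (κ : Cardinal.{u}) {X : Type v} [TopologicalSpace X] (D : Set X) : Prop :=
  ∃ o ≤ κ.ord, ∃ U : Iio o → Set X, (∀ i, IsOpen (U i) ∧ Dense (U i)) ∧ ⋂ i, U i ⊆ D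

/-- `C ∩ N` is a co-meager subset of the subspace `N`. -/
def ComeagerIn (κ : Cardinal.{u}) {X : Type v} [TopologicalSpace X] (N C : Set X) : Prop :=
  Comeager κ (Subtype.val ⁻¹' C : Set N)

/-! ### The equivalence relations -/

/-- Equality modulo a bounded set of coordinates. -/
def E0 {κ : Cardinal.{u}} (η ξ : Cantor κ) : Prop :=
  ∃ β < κ.ord, ∀ γ : Iio κ.ord, β < γ.1 → η γ = ξ γ

/-- `E*_S`: for each `α ∈ S` the function `η △ ξ` is constant on some `(β, α)`, `β < α`. -/
def EStar {κ : Cardinal.{u}} (S : Set Ordinal.{u}) (η ξ : Cantor κ) : Prop :=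
  ∀ α ∈ S, α < κ.ord → ∃ β < α, ∃ v : Bool, ∀ γ : Iio κ.ord,
    β < γ.1 → γ.1 < α → xor (η γ) (ξ γ) = v

/-- `E_S = E*_S ∩ E_0`, for sets `S` of limit ordinals below `κ`. -/
def ES (κ : Cardinal.{u}) (S : Set Ordinal.{u}) (η ξ : Cantor κ) : Prop :=
  EStar S η ξ ∧ E0 η ξ

/-- The product of two relations, on the product space. -/
def prodRel {X : Type v} {Y : Type w} (E : X → X → Prop) (E' : Y → Y → Prop)
    (a b : X × Y) : Prop :=
  E a.1 b.1 ∧ E' a.2 b.2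

/-! ### Square sequences and non-reflecting sets -/

/-- The limit points of `X` below `α`. -/
def limBelow (α : Ordinal.{u}) (X : Set Ordinal.{u}) : Set Ordinal.{u} :=
  {β | β < α ∧ β ≠ 0 ∧ UnboundedIn β X}

/-- `⟨C_α | α ∈ S^κ_{≤ μ}⟩` is a `□^κ_μ`-sequence (values of `C` elsewhere are irrelevant). -/
def IsSquareSeq (κ μ : Cardinal.{u}) (C : Ordinal.{u} → Set Ordinal.{u}) : Prop :=
  ∀ α ∈ cofLe κ μ,
    (C α ⊆ Iio α ∧ limBelow α (C α) ⊆ C α ∧ UnboundedIn α (C α)) ∧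
    (∀ β ∈ limBelow α (C α), β ∈ cofLe κ μ ∧ C β = Iio β ∩ C α) ∧
    (α.cof < μ → #(C α) < Cardinal.lift.{u + 1} μ)

/-- `B ⊆ S` does not reflect to any `α ∈ S^κ_{≤ μ}` of uncountable cofinality, and this is
witnessed by the sets of limit points of the sets `C_α` of a square sequence. -/
def IsNonreflectingPart (κ μ : Cardinal.{u}) (C : Ordinal.{u} → Set Ordinal.{u})
    (S B : Set Ordinal.{u}) : Prop :=
  B ⊆ S ∧ ∀ α ∈ cofLe κ μ ∩ cofGe κ ℵ₁, limBelow α (C α) ⊆ Iio α \ B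

end CubGames

namespace CubGames

/-! ### Approximations and transfinite runs -/

/-! All five parts come from one game. A Borel map is continuous on a comeager set, so it suffices
to refute continuous reductions on comeager sets. For a product source, one coordinate is kept
common to both points, so that only the other relation matters.

Suppose that a reduction of `E_S` to the relations `E_{T c}` (one or two values of `c`) is given.
Approximate two points `η`, `ξ` by a position, legal if the difference is eventually constant below
each `δ ∈ S` up to its length. A legal position extends to points in the comeager set whose
difference is constantly 0 or constantly 1 from then on. With 0 the points are equivalent, so their
images agree eventually. With 1 they are not, and some image coordinate has unboundedly many
disagreements: otherwise the failure would occur at a single `δ ∈ T c`, would be decided by an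
initial segment, and would persist after switching the tail to 0 (`Tail.exists_not_e0`). By
continuity, agreements and disagreements are forced by initial segments, and one `c` works above a
fixed position.

Player II answers a move by extending the position so that an agreement and a disagreement in
coordinate `c` are forced above that move. As long as the limits passed avoid `S`, positions stay
legal. The final supremum cannot lie in `T c \ S`: the position would extend to equivalent points
whose images have a difference that is not eventually constant below it. This is `exists_strategy`.

It remains to find a play with supremum in `T c \ S` whose earlier limits avoid `S`. In part 1 the
earlier limits have cofinality below `λ`, hence avoid `S`, and the characterization of the game
turns the strategy into a `λ`-cub set disjoint from `T c \ S`. In the other parts player I moves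
along a ladder: a cofinal `ω`-sequence, or a set from the square sequence, whose limit points lie
outside `S`. For cub many `α` the play along the ladder of `α` converges to `α`
(`IsLadderSystem.exists_play`), since coherence leaves fewer than `κ` initial segments of ladders
below each bound. -/

theorem iSup_Iio_lt_of_card_lt_cof {i o : Ordinal.{u}} (hi : i.card < o.cof)
    {f : Iio i → Ordinal.{u}} (hf : ∀ j, f j < o) : ⨆ j, f j < o := by
  apply Ordinal.lift_iSup_lt_of_lt_cof _ hf
  rw [Cardinal.mk_Iio_ordinal, ← Ordinal.lift_cof, Cardinal.lift_lift]
  exact Cardinal.lift_lt.2 hi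

theorem iSup_Iio_lt_ord {κ : Cardinal.{u}} (hκ : κ.IsRegular) {i : Ordinal.{u}} (hi : i < κ.ord)
    {f : Iio i → Ordinal.{u}} (hf : ∀ j, f j < κ.ord) : ⨆ j, f j < κ.ord :=
  iSup_Iio_lt_of_card_lt_cof (by rw [hκ.cof_ord]; exact Cardinal.lt_ord.1 hi) hf

theorem succ_lt_ord {κ : Cardinal.{u}} (hκ : κ.IsRegular) {α : Ordinal.{u}} (h : α < κ.ord) :
    Order.succ α < κ.ord :=
  (Cardinal.isSuccLimit_ord hκ.aleph0_le).succ_lt h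

/-- The functions `x` and `y` have the same values below `α`. -/
def Agree {κ : Cardinal.{u}} {V : Type*} (α : Ordinal.{u}) (x y : Iio κ.ord → V) : Prop :=
  ∀ γ : Iio κ.ord, γ.1 < α → x γ = y γ

/-- A function defined on an initial segment `len` of `κ`, given as the restriction of a total
function. -/
structure Approx (κ : Cardinal.{u}) (V : Type*) where
  /-- the length of the approximation -/
  len : Ordinal.{u}
  /-- a total function, only the values below `len` matter -/
  val : Iio κ.ord → V

namespace Approx

variable {κ : Cardinal.{u}} {V : Type v}

/-- The total function `x` extends the approximation `P`. -/
def Ext (P : Approx κ V) (x : Iio κ.ord → V) : Prop := Agree P.len P.val x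

instance : Preorder (Approx κ V) where
  le P Q := P.len ≤ Q.len ∧ Agree P.len P.val Q.val
  le_refl P := ⟨le_rfl, fun _ _ => rfl⟩
  le_trans P Q R h h' :=
    ⟨h.1.trans h'.1, fun γ hγ => (h.2 γ hγ).trans (h'.2 γ (hγ.trans_le h.1))⟩

theorem Ext.mono {P Q : Approx κ V} {x : Iio κ.ord → V} (h : Q.Ext x) (hPQ : P ≤ Q) : P.Ext x :=
  fun γ hγ => (hPQ.2 γ hγ).trans (h γ (hγ.trans_le hPQ.1))

theorem Ext.le {P : Approx κ V} {x : Iio κ.ord → V} (h : P.Ext x) {α : Ordinal.{u}}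
    (hα : P.len ≤ α) : P ≤ ⟨α, x⟩ := ⟨hα, h⟩

theorem ext_val (P : Approx κ V) : P.Ext P.val := fun _ _ => rfl

open Classical in
/-- The union of `P₀` and a family of approximations. -/
noncomputable def glue (P₀ : Approx κ V) {i : Ordinal.{u}} (F : Iio i → Approx κ V) :
    Approx κ V where
  len := max P₀.len (⨆ j, (F j).len)
  val γ := if h : ∃ j, γ.1 < (F j).len then (F h.choose).val γ else P₀.val γ

/-- The index chosen in `glue` is immaterial: in an increasing family, any two members long enough
to decide a value decide it in the same way. -/
theorem glue_upper {P₀ : Approx κ V} {i : Ordinal.{u}} {F : Iio i → Approx κ V}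
    (h₀ : ∀ j, P₀ ≤ F j) (hF : ∀ j k, j < k → F j ≤ F k) :
    P₀ ≤ glue P₀ F ∧ ∀ j, F j ≤ glue P₀ F := by
  have key : ∀ (j) (γ : Iio κ.ord), γ.1 < (F j).len → (glue P₀ F).val γ = (F j).val γ := by
    intro j γ hγ
    have h : ∃ j, γ.1 < (F j).len := ⟨j, hγ⟩
    simp only [glue, dif_pos h]
    rcases lt_trichotomy h.choose j with h' | h' | h'
    · exact (hF _ _ h').2 γ h.choose_spec
    · rw [h']
    · exact ((hF _ _ h').2 γ hγ).symm
  refine ⟨⟨le_max_left _ _, fun γ hγ => ?_⟩, fun j => ⟨?_, fun γ hγ => (key j γ hγ).symm⟩⟩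
  · by_cases h : ∃ j, γ.1 < (F j).len
    · obtain ⟨j, hj⟩ := h
      rw [key j γ hj]
      exact (h₀ j).2 γ hγ
    · simp only [glue, dif_neg h]
  · exact (Ordinal.le_iSup (fun j => (F j).len) j).trans (le_max_right _ _)

/-- The approximation reached before move `i` when the moves `step j` are made one after the
other, starting with `P₀` and taking unions at limits. -/
noncomputable def run (step : Ordinal.{u} → Approx κ V → Approx κ V) (P₀ : Approx κ V)
    (i : Ordinal.{u}) : Approx κ V :=
  glue P₀ fun j : Iio i => step j.1 (run step P₀ j.1)
termination_by i
decreasing_by exact j.2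

variable {step : Ordinal.{u} → Approx κ V → Approx κ V} {P₀ : Approx κ V}

/-- Both clauses are proved in one induction, since together they supply the monotonicity that
`glue_upper` asks for. -/
theorem run_upper (hstep : ∀ j P, P ≤ step j P) (i : Ordinal.{u}) :
    P₀ ≤ run step P₀ i ∧ ∀ j < i, step j (run step P₀ j) ≤ run step P₀ i := by
  induction i using WellFoundedLT.induction with
  | _ i ih =>
    have := glue_upper (P₀ := P₀) (F := fun j : Iio i => step j.1 (run step P₀ j.1))
      (fun j => (ih j.1 j.2).1.trans (hstep _ _))
      (fun j k hjk => ((ih k.1 k.2).2 j.1 hjk).trans (hstep _ _))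
    rw [run]
    exact ⟨this.1, fun j hj => this.2 ⟨j, hj⟩⟩

theorem le_run (hstep : ∀ j P, P ≤ step j P) (i : Ordinal.{u}) : P₀ ≤ run step P₀ i :=
  (run_upper hstep i).1

theorem step_le_run (hstep : ∀ j P, P ≤ step j P) {j i : Ordinal.{u}} (h : j < i) :
    step j (run step P₀ j) ≤ run step P₀ i :=
  (run_upper hstep i).2 j h

theorem run_congr {step' : Ordinal.{u} → Approx κ V → Approx κ V} {i : Ordinal.{u}}
    (h : ∀ j < i, step j = step' j) : run step P₀ i = run step' P₀ i := by
  induction i using WellFoundedLT.induction with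
  | _ i ih =>
    rw [run, run]
    congr 1
    funext j
    rw [ih j.1 j.2 fun k hk => h k (hk.trans j.2), h j.1 j.2]

theorem run_len (i : Ordinal.{u}) : (run step P₀ i).len =
    max P₀.len (⨆ j : Iio i, (step j.1 (run step P₀ j.1)).len) := by
  rw [run]; rfl

theorem run_len_lt (hκ : κ.IsRegular) (h₀ : P₀.len < κ.ord)
    (hstep : ∀ j P, P.len < κ.ord → (step j P).len < κ.ord) {i : Ordinal.{u}} (hi : i < κ.ord) :
    (run step P₀ i).len < κ.ord := by
  induction i using WellFoundedLT.induction with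
  | _ i ih =>
    rw [run_len]
    exact max_lt h₀ (iSup_Iio_lt_ord hκ hi fun j => hstep _ _ (ih j.1 j.2 (lt_trans j.2 hi)))

/-- The Baire category theorem for functions on `κ`. -/
theorem exists_generic (hκ : κ.IsRegular) (h₀ : P₀.len < κ.ord)
    (good : Iio κ.ord → (Iio κ.ord → V) → Prop)
    (hgood : ∀ i P, P₀ ≤ P → P.len < κ.ord →
      ∃ Q, P ≤ Q ∧ Q.len < κ.ord ∧ ∀ x, Q.Ext x → good i x) :
    ∃ x, P₀.Ext x ∧ ∀ i, good i x := by
  classical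
  choose! nx h1 h2 h3 using hgood
  -- Outside the range of `hgood` the step does nothing, which makes it extending and
  -- length-preserving without side conditions.
  let step : Ordinal.{u} → Approx κ V → Approx κ V := fun i P =>
    if h : i < κ.ord then (if P₀ ≤ P ∧ P.len < κ.ord then nx ⟨i, h⟩ P else P) else P
  have hs : ∀ j P, P ≤ step j P := by
    intro j P
    simp only [step]
    split_ifs with h h'
    · exact h1 _ _ h'.1 h'.2
    · exact le_rfl
    · exact le_rfl
  have hl : ∀ j P, P.len < κ.ord → (step j P).len < κ.ord := by
    intro j P hP
    simp only [step]
    split_ifs with h h'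
    · exact h2 _ _ h'.1 h'.2
    · exact hP
    · exact hP
  refine ⟨(run step P₀ κ.ord).val, (le_run hs _).2, fun i => ?_⟩
  have hle := step_le_run (P₀ := P₀) hs i.2
  have hx := (ext_val (run step P₀ κ.ord)).mono hle
  have e : step i.1 (run step P₀ i.1) = nx i (run step P₀ i.1) := by
    have : i.1 < κ.ord := i.2
    simp only [step, dif_pos this, if_pos (And.intro (le_run hs i.1) (run_len_lt hκ h₀ hl i.2))]
  rw [e] at hx
  exact h3 i _ (le_run hs i.1) (run_len_lt hκ h₀ hl i.2) _ hx

/-- `C` contains an intersection of `κ` many sets which are open and dense above `R`. -/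
def ComeagerAbove (R : Approx κ V) (C : Set (Iio κ.ord → V)) : Prop :=
  ∃ U : Iio κ.ord → Set (Iio κ.ord → V),
    (∀ i P, R ≤ P → P.len < κ.ord → ∃ Q, P ≤ Q ∧ Q.len < κ.ord ∧ ∀ x, Q.Ext x → x ∈ U i) ∧
    ∀ x, R.Ext x → (∀ i, x ∈ U i) → x ∈ C

/-- Above each approximation a comeager set contains two functions related by a given
coordinatewise permutation. -/
theorem ComeagerAbove.exists_pair (hκ : κ.IsRegular) {R P : Approx κ V}
    {C : Set (Iio κ.ord → V)} (hC : ComeagerAbove R C) (φ : Iio κ.ord → V ≃ V)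
    (hP : P.len < κ.ord) (hRP : R ≤ P) (hRP' : R.Ext fun γ => φ γ (P.val γ)) :
    ∃ x, P.Ext x ∧ x ∈ C ∧ (fun γ => φ γ (x γ)) ∈ C := by
  obtain ⟨U, hU, hUC⟩ := hC
  obtain ⟨x, hx, hg⟩ := exists_generic hκ hP
    (fun i x => x ∈ U i ∧ (fun γ => φ γ (x γ)) ∈ U i) (by
      intro i Q hQ hQl
      obtain ⟨Q₁, h1, h1l, h1U⟩ := hU i Q (hRP.trans hQ) hQl
      -- First `x` enters `U i`, then its permuted image does; the second extension is pulled back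
      -- along `φ` to an extension for `x`.
      obtain ⟨Q₂, h2, h2l, h2U⟩ := hU i ⟨Q₁.len, fun γ => φ γ (Q₁.val γ)⟩
        ⟨(hRP.trans (hQ.trans h1)).1, fun γ hγ => by
          rw [hRP' γ hγ]
          exact congrArg _ ((hQ.trans h1).2 γ (hγ.trans_le hRP.1))⟩ h1l
      have h12 : Q₁ ≤ ⟨Q₂.len, fun γ => (φ γ).symm (Q₂.val γ)⟩ :=
        ⟨h2.1, fun γ hγ =>
          (φ γ).eq_symm_apply.2 (h2.2 γ hγ)⟩
      refine ⟨⟨Q₂.len, fun γ => (φ γ).symm (Q₂.val γ)⟩, h1.trans h12, h2l, fun x hx => ⟨?_, ?_⟩⟩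
      · exact h1U _ (hx.mono h12)
      · refine h2U _ fun γ hγ => ?_
        rw [← hx γ hγ, Equiv.apply_symm_apply])
  refine ⟨x, hx, hUC _ (hx.mono hRP) fun i => (hg i).1, hUC _ ?_ fun i => (hg i).2⟩
  intro γ hγ
  rw [hRP' γ hγ]
  exact congrArg _ (hx γ (hγ.trans_le hRP.1))

end Approx

end CubGames

namespace CubGames

/-! ### Reductions along pairs of approximations -/

variable {κ : Cardinal.{u}}

/-- The difference of `η` and `ξ` is constant on some interval `(β, δ)`, `β < δ`. -/
def DiffConstAt (δ : Ordinal.{u}) (η ξ : Iio κ.ord → Bool) : Prop :=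
  ∃ β < δ, ∃ v : Bool, ∀ γ : Iio κ.ord, β < γ.1 → γ.1 < δ → xor (η γ) (ξ γ) = v

theorem estar_iff {S : Set Ordinal.{u}} {η ξ : Cantor κ} :
    EStar S η ξ ↔ ∀ δ ∈ S, δ < κ.ord → DiffConstAt δ η ξ := Iff.rfl

theorem DiffConstAt.congr {δ : Ordinal.{u}} {η ξ η' ξ' : Iio κ.ord → Bool}
    (h : DiffConstAt δ η ξ) (hη : Agree δ η η') (hξ : Agree δ ξ ξ') : DiffConstAt δ η' ξ' := by
  obtain ⟨β, hβ, v, hv⟩ := h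
  refine ⟨β, hβ, v, fun γ h1 h2 => ?_⟩
  rw [← hη γ h2, ← hξ γ h2]
  exact hv γ h1 h2

theorem Agree.symm {V : Type*} {δ : Ordinal.{u}} {x y : Iio κ.ord → V} (h : Agree δ x y) :
    Agree δ y x := fun γ hγ => (h γ hγ).symm

theorem Agree.mono {V : Type*} {δ δ' : Ordinal.{u}} {x y : Iio κ.ord → V} (h : Agree δ x y)
    (h' : δ' ≤ δ) : Agree δ' x y := fun γ hγ => h γ (hγ.trans_le h')

theorem Agree.comp {V W : Type*} {δ : Ordinal.{u}} {x y : Iio κ.ord → V} (h : Agree δ x y)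
    (φ : V → W) : Agree δ (fun γ => φ (x γ)) fun γ => φ (y γ) :=
  fun γ hγ => congrArg φ (h γ hγ)

/-- The first of the two points coded by a triple of functions. -/
def left (t : Iio κ.ord → Bool × Bool × Bool) : Iio κ.ord → Bool × Bool :=
  fun γ => ((t γ).1, (t γ).2.2)

/-- The second of the two points coded by a triple of functions. -/
def right (t : Iio κ.ord → Bool × Bool × Bool) : Iio κ.ord → Bool × Bool :=
  fun γ => ((t γ).2.1, (t γ).2.2)

/-- The first coordinate of a point. -/
def coord (x : Iio κ.ord → Bool × Bool) : Cantor κ := fun γ => (x γ).1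

theorem Agree.left {δ : Ordinal.{u}} {s t : Iio κ.ord → Bool × Bool × Bool} (h : Agree δ s t) :
    Agree δ (left s) (left t) := h.comp fun a : Bool × Bool × Bool => (a.1, a.2.2)

theorem Agree.right {δ : Ordinal.{u}} {s t : Iio κ.ord → Bool × Bool × Bool} (h : Agree δ s t) :
    Agree δ (right s) (right t) := h.comp fun a : Bool × Bool × Bool => (a.2.1, a.2.2)

/-- The data of a continuous reduction to a product `E_{T false} ⊗ E_{T true}`, defined on a
comeager set `C` of pairs and reducing `E_S` of the first coordinates when the second coordinates
are equal. -/
structure PairReduction (κ : Cardinal.{u}) (S : Set Ordinal.{u})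
    (T : Bool → Set Ordinal.{u}) where
  /-- the root of the open set in which `C` is comeager -/
  root : Approx κ (Bool × Bool)
  /-- the domain of the reduction -/
  C : Set (Iio κ.ord → Bool × Bool)
  /-- the two coordinates of the reduction -/
  g : Bool → (Iio κ.ord → Bool × Bool) → Cantor κ
  root_lt : root.len < κ.ord
  comeager : Approx.ComeagerAbove root C
  cont : ∀ c, ∀ x ∈ C, ∀ δ < κ.ord, ∃ α < κ.ord, ∀ y ∈ C, Agree α x y → Agree δ (g c x) (g c y)
  reduces : ∀ x ∈ C, ∀ y ∈ C, (∀ γ, (x γ).2 = (y γ).2) →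
    (ES κ S (coord x) (coord y) ↔ ∀ c, ES κ (T c) (g c x) (g c y))

namespace PairReduction

variable {S : Set Ordinal.{u}} {T : Bool → Set Ordinal.{u}} (ρ : PairReduction κ S T)

/-- The initial position of the game. -/
def init : Approx κ (Bool × Bool × Bool) :=
  ⟨ρ.root.len, fun γ => ((ρ.root.val γ).1, (ρ.root.val γ).1, (ρ.root.val γ).2)⟩

/-- The positions which occur in the construction. -/
structure Legal (P : Approx κ (Bool × Bool × Bool)) : Prop where
  init_le : ρ.init ≤ P
  len_lt : P.len < κ.ord
  diff : ∀ δ ∈ S, δ ≤ P.len → DiffConstAt δ (coord (left P.val)) (coord (right P.val))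

variable {ρ}

/-- Both points start out equal. The value 0 has to be excluded because `DiffConstAt 0` fails for
want of some `β < 0`. -/
theorem legal_init (hS : (0 : Ordinal.{u}) ∉ S) : ρ.Legal ρ.init where
  init_le := le_rfl
  len_lt := ρ.root_lt
  diff δ hδ _ := by
    refine ⟨0, pos_iff_ne_zero.2 fun h => hS (h ▸ hδ), false, fun γ _ _ => ?_⟩
    simp [coord, left, right, init]

variable {P Q : Approx κ (Bool × Bool × Bool)}

/-- `t` extends `P`, both its points are in `C`, and their difference is `v` from `P.len` on. -/
structure Tail (ρ : PairReduction κ S T) (v : Bool) (P : Approx κ (Bool × Bool × Bool))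
    (t : Iio κ.ord → Bool × Bool × Bool) : Prop where
  ext : P.Ext t
  tail : ∀ γ : Iio κ.ord, P.len ≤ γ.1 → xor (coord (left t) γ) (coord (right t) γ) = v
  left_mem : left t ∈ ρ.C
  right_mem : right t ∈ ρ.C

open Classical in
-- The prescribed difference `m` is the one of `P` below its length and `v` afterwards. Adding `m`
-- is a coordinatewise involution, so the comeager set contains a point together with its translate.
theorem Legal.exists_tail (hκ : κ.IsRegular) (hP : ρ.Legal P) (v : Bool) :
    ∃ t, ρ.Tail v P t := by
  let m : Iio κ.ord → Bool := fun γ =>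
    if γ.1 < P.len then xor (P.val γ).1 (P.val γ).2.1 else v
  let φ : Iio κ.ord → Bool × Bool ≃ Bool × Bool := fun γ =>
    (Function.Involutive.toPerm (fun a : Bool × Bool => (xor (m γ) a.1, a.2))
      (fun a => by simp))
  obtain ⟨x, hx, h1, h2⟩ := ρ.comeager.exists_pair (P := ⟨P.len, left P.val⟩) hκ φ hP.len_lt
    ⟨hP.init_le.1, fun γ hγ => by
      have := hP.init_le.2 γ hγ
      simp only [left, ← this]
      rfl⟩
    (by
      intro γ hγ
      have := hP.init_le.2 γ hγ
      have h' : γ.1 < P.len := hγ.trans_le hP.init_le.1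
      simp only [φ, m, left, if_pos h', Function.Involutive.coe_toPerm, ← this]
      simp [init])
  refine ⟨fun γ => ((x γ).1, xor (m γ) (x γ).1, (x γ).2), ?_, ?_, ?_, ?_⟩
  · intro γ hγ
    have := hx γ hγ
    simp only [left] at this
    simp only [← this, m, if_pos hγ]
    refine Prod.ext rfl (Prod.ext ?_ rfl)
    cases (P.val γ).1 <;> simp
  · intro γ hγ
    simp only [coord, left, right, m, if_neg (not_lt.2 hγ)]
    cases v <;> simp
  · exact h1
  · exact h2

/-- Beyond `P.len` the difference is constant, so no `δ ∈ S` past that point can be violated. -/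
theorem Tail.legal {v : Bool} {t : Iio κ.ord → Bool × Bool × Bool} (h : ρ.Tail v P t)
    (hP : ρ.Legal P) {α : Ordinal.{u}} (hα : P.len ≤ α) (hα' : α < κ.ord) :
    ρ.Legal ⟨α, t⟩ where
  init_le := hP.init_le.trans (h.ext.le hα)
  len_lt := hα'
  diff δ hδ hδα := by
    rcases le_or_gt δ P.len with h' | h'
    · exact (hP.diff δ hδ h').congr
        ((Agree.left h.ext).mono h' |>.comp Prod.fst) ((Agree.right h.ext).mono h' |>.comp Prod.fst)
    · exact ⟨P.len, h', v, fun γ h1 _ => h.tail γ h1.le⟩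

theorem Tail.es {t : Iio κ.ord → Bool × Bool × Bool} (h : ρ.Tail false P t)
    (hP : ρ.Legal P) : ES κ S (coord (left t)) (coord (right t)) := by
  refine ⟨fun δ hδ hδκ => ?_, P.len, hP.len_lt, fun γ hγ => ?_⟩
  · exact (h.legal hP (le_max_left P.len δ) (max_lt hP.len_lt hδκ)).diff δ hδ (le_max_right _ _)
  · simpa using h.tail γ hγ.le

theorem Tail.es_image {t : Iio κ.ord → Bool × Bool × Bool} (h : ρ.Tail false P t)
    (hP : ρ.Legal P) (c : Bool) : ES κ (T c) (ρ.g c (left t)) (ρ.g c (right t)) :=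
  (ρ.reduces _ h.left_mem _ h.right_mem fun _ => rfl).1 (h.es hP) c

/-- Below `P`, the images differ at `γ` (if `b`), or are equal at `γ` (if not `b`). -/
def Forced (ρ : PairReduction κ S T) (c : Bool) (P : Approx κ (Bool × Bool × Bool))
    (γ : Iio κ.ord) (b : Bool) : Prop :=
  ∀ t, P.Ext t → left t ∈ ρ.C → right t ∈ ρ.C →
    xor (ρ.g c (left t) γ) (ρ.g c (right t) γ) = b

theorem Forced.mono {c : Bool} {γ : Iio κ.ord} {b : Bool} (h : ρ.Forced c P γ b) (hPQ : P ≤ Q) :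
    ρ.Forced c Q γ b :=
  fun t ht h1 h2 => h t (ht.mono hPQ) h1 h2

/-- Long enough initial segments of `t` determine the images below `δ`. -/
theorem Tail.exists_determined {v : Bool} {t : Iio κ.ord → Bool × Bool × Bool}
    (h : ρ.Tail v P t) (c : Bool) {δ β : Ordinal.{u}} (hδ : δ < κ.ord) (hβ : β < κ.ord) :
    ∃ α < κ.ord, β ≤ α ∧ ∀ s, left s ∈ ρ.C → right s ∈ ρ.C → Agree α t s →
      Agree δ (ρ.g c (left t)) (ρ.g c (left s)) ∧ Agree δ (ρ.g c (right t)) (ρ.g c (right s)) := by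
  obtain ⟨α₁, h1, h1'⟩ := ρ.cont c _ h.left_mem δ hδ
  obtain ⟨α₂, h2, h2'⟩ := ρ.cont c _ h.right_mem δ hδ
  refine ⟨max β (max α₁ α₂), max_lt hβ (max_lt h1 h2), le_max_left _ _, fun s hl hr hs => ?_⟩
  exact ⟨h1' _ hl (hs.left.mono ((le_max_left _ _).trans (le_max_right _ _))),
    h2' _ hr (hs.right.mono ((le_max_right _ _).trans (le_max_right _ _)))⟩

theorem Tail.exists_forced (hκ : κ.IsRegular) {v : Bool} {t : Iio κ.ord → Bool × Bool × Bool}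
    (h : ρ.Tail v P t) (hP : ρ.Legal P) (c : Bool) (γ : Iio κ.ord) :
    ∃ Q, P ≤ Q ∧ ρ.Legal Q ∧ γ.1 < Q.len ∧
      ρ.Forced c Q γ (xor (ρ.g c (left t) γ) (ρ.g c (right t) γ)) := by
  have hγ := succ_lt_ord hκ γ.2
  obtain ⟨α, hα, hβα, hdet⟩ := h.exists_determined c hγ (max_lt hP.len_lt hγ)
  have hPα := (le_max_left _ _).trans hβα
  refine ⟨⟨α, t⟩, h.ext.le hPα, h.legal hP hPα hα,
    (Order.lt_succ γ.1).trans_le ((le_max_right _ _).trans hβα), fun s hs hl hr => ?_⟩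
  obtain ⟨e1, e2⟩ := hdet s hl hr hs
  rw [e1 γ (Order.lt_succ _), e2 γ (Order.lt_succ _)]

theorem Legal.exists_forced_eq (hκ : κ.IsRegular) (hP : ρ.Legal P) (c : Bool) {β : Ordinal.{u}}
    (hβ : β < κ.ord) :
    ∃ Q, P ≤ Q ∧ ρ.Legal Q ∧ ∃ γ : Iio κ.ord, β < γ.1 ∧ γ.1 < Q.len ∧ ρ.Forced c Q γ false := by
  obtain ⟨t, ht⟩ := hP.exists_tail hκ false
  obtain ⟨-, β', hβ', heq⟩ := ht.es_image hP c
  let γ : Iio κ.ord := ⟨Order.succ (max β β'), succ_lt_ord hκ (max_lt hβ hβ')⟩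
  have hγ : max β β' < γ.1 := Order.lt_succ _
  obtain ⟨Q, h1, h2, h3, h4⟩ := ht.exists_forced hκ hP c γ
  rw [heq γ ((le_max_right _ _).trans_lt hγ), Bool.xor_self] at h4
  exact ⟨Q, h1, h2, γ, (le_max_left _ _).trans_lt hγ, h3, h4⟩

/-- Tails that differ everywhere make the points inequivalent. If the images were nevertheless equal
modulo bounded sets in each coordinate, inequivalence would show at some `δ ∈ T c`, hence in the
images below `δ`, which a legal initial segment determines. Continuing that segment by equal tails
gives equivalent points with the same images below `δ`, a contradiction. -/
theorem Tail.exists_not_e0 (hκ : κ.IsRegular) {t : Iio κ.ord → Bool × Bool × Bool}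
    (ht : ρ.Tail true P t) (hP : ρ.Legal P) :
    ∃ c, ¬ E0 (ρ.g c (left t)) (ρ.g c (right t)) := by
  by_contra! hE0
  have hne : ¬ ES κ S (coord (left t)) (coord (right t)) := by
    rintro ⟨-, β, hβ, h⟩
    let γ : Iio κ.ord := ⟨Order.succ (max β P.len), succ_lt_ord hκ (max_lt hβ hP.len_lt)⟩
    have hγ : max β P.len < γ.1 := Order.lt_succ _
    have h1 := ht.tail γ ((le_max_right _ _).trans_lt hγ).le
    rw [h γ ((le_max_left _ _).trans_lt hγ), Bool.xor_self] at h1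
    exact Bool.false_ne_true h1
  rw [ρ.reduces _ ht.left_mem _ ht.right_mem fun _ => rfl] at hne
  push Not at hne
  obtain ⟨c, hc⟩ := hne
  have hst : ¬ EStar (T c) (ρ.g c (left t)) (ρ.g c (right t)) := fun h => hc ⟨h, hE0 c⟩
  rw [estar_iff] at hst
  push Not at hst
  obtain ⟨δ, hδ, hδκ, hnd⟩ := hst
  obtain ⟨α, hα, hPα, hdet⟩ := ht.exists_determined c hδκ hP.len_lt
  have hQ := ht.legal hP hPα hα
  obtain ⟨s, hs⟩ := hQ.exists_tail hκ false
  obtain ⟨e1, e2⟩ := hdet s hs.left_mem hs.right_mem hs.ext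
  have hd : DiffConstAt δ (ρ.g c (left s)) (ρ.g c (right s)) := (hs.es_image hQ c).1 δ hδ hδκ
  exact hnd (hd.congr e1.symm e2.symm)

theorem Legal.exists_forced_ne (hκ : κ.IsRegular) (hP : ρ.Legal P) :
    ∃ c, ∀ β < κ.ord, ∃ Q, P ≤ Q ∧ ρ.Legal Q ∧
      ∃ γ : Iio κ.ord, β < γ.1 ∧ γ.1 < Q.len ∧ ρ.Forced c Q γ true := by
  obtain ⟨t, ht⟩ := hP.exists_tail hκ true
  obtain ⟨c, hc⟩ := ht.exists_not_e0 hκ hP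
  refine ⟨c, fun β hβ => ?_⟩
  unfold E0 at hc
  push Not at hc
  obtain ⟨γ, hβγ, hγ⟩ := hc β hβ
  obtain ⟨Q, h1, h2, h3, h4⟩ := ht.exists_forced hκ hP c γ
  have hx : xor (ρ.g c (left t) γ) (ρ.g c (right t) γ) = true := bne_iff_ne.2 hγ
  rw [hx] at h4
  exact ⟨Q, h1, h2, γ, hβγ, h3, h4⟩

/-- Failure of a coordinate above a bound is inherited by extensions. If no `P₀` worked, both
coordinates could be made to fail at a single position, against `Legal.exists_forced_ne`. -/
theorem exists_forced_ne_above (hκ : κ.IsRegular) (hS : (0 : Ordinal.{u}) ∉ S) :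
    ∃ c P₀, ρ.Legal P₀ ∧ ∀ P, P₀ ≤ P → ρ.Legal P → ∀ β < κ.ord, ∃ Q, P ≤ Q ∧ ρ.Legal Q ∧
      ∃ γ : Iio κ.ord, β < γ.1 ∧ γ.1 < Q.len ∧ ρ.Forced c Q γ true := by
  by_contra! H
  obtain ⟨P, -, hP, β, hβ, h⟩ := H false ρ.init (legal_init hS)
  obtain ⟨P', hPP', hP', β', hβ', h'⟩ := H true P hP
  obtain ⟨c, hc⟩ := hP'.exists_forced_ne hκ
  cases c
  · obtain ⟨Q, h1, h2, γ, h3, h4, h5⟩ := hc β hβ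
    exact h Q (hPP'.trans h1) h2 γ h3 h4 h5
  · obtain ⟨Q, h1, h2, γ, h3, h4, h5⟩ := hc β' hβ'
    exact h' Q h1 h2 γ h3 h4 h5

end PairReduction

end CubGames

/-! ### The strategy of player II extracted from a reduction -/

namespace CubGames

variable {κ : Cardinal.{u}}

/-- The ordinal `α`, as an element of `κ`, or zero if `α` is not below `κ`. -/
noncomputable def toIio (hκ : κ.IsRegular) (α : Ordinal.{u}) : Iio κ.ord :=
  if h : α < κ.ord then ⟨α, h⟩ else ⟨0, hκ.ord_pos⟩

theorem coe_toIio (hκ : κ.IsRegular) {α : Ordinal.{u}} (h : α < κ.ord) :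
    (toIio hκ α : Ordinal.{u}) = α := by
  rw [toIio, dif_pos h]

/-- The strategy of player II answering each move `b` of player I by the length of `next b P`,
where `P` is the position reached so far. -/
noncomputable def lengthStrategy {V : Type v} (hκ : κ.IsRegular)
    (next : Iio κ.ord → Approx κ V → Approx κ V) (P₀ : Approx κ V) : StrategyII κ :=
  fun i h =>
    -- The default value at later moves is harmless: the run before `i` depends only on the moves
    -- before `i`.
    let a : Ordinal.{u} → Iio κ.ord := fun j => if hj : j ≤ i then h ⟨j, hj⟩ else ⟨0, hκ.ord_pos⟩
    toIio hκ (next (a i) (Approx.run (fun j => next (a j)) P₀ i)).len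

theorem reply_lengthStrategy {V : Type v} (hκ : κ.IsRegular)
    {next : Iio κ.ord → Approx κ V → Approx κ V} {P₀ : Approx κ V} {lam : Cardinal.{u}}
    (a : Ordinal.{u} → Iio κ.ord) (i : Iio lam.ord) :
    (lengthStrategy hκ next P₀).reply (fun i : Iio lam.ord => a i) i =
      toIio hκ (next (a i) (Approx.run (fun j => next (a j)) P₀ i)).len := by
  simp only [StrategyII.reply, lengthStrategy, le_refl, dite_true]
  congr 3
  refine Approx.run_congr fun j hj => ?_
  simp [hj.le]

namespace PairReduction

variable {S : Set Ordinal.{u}} {T : Bool → Set Ordinal.{u}} {ρ : PairReduction κ S T}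

/-- The position is extended by `next b` to a position longer than `b` which forces the images
to differ, and to be equal, at certain points above `b`. -/
structure IsNext (ρ : PairReduction κ S T) (c : Bool) (P₀ : Approx κ (Bool × Bool × Bool))
    (next : Iio κ.ord → Approx κ (Bool × Bool × Bool) → Approx κ (Bool × Bool × Bool)) :
    Prop where
  le : ∀ b P, P ≤ next b P
  lt_len : ∀ b P, b.1 < (next b P).len
  len_lt : ∀ b P, P.len < κ.ord → (next b P).len < κ.ord
  legal : ∀ b P, P₀ ≤ P → ρ.Legal P → ρ.Legal (next b P)
  forced : ∀ b P, P₀ ≤ P → ρ.Legal P → ∀ v, ∃ γ : Iio κ.ord, b.1 < γ.1 ∧ γ.1 < (next b P).len ∧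
    ρ.Forced c (next b P) γ v

theorem exists_isNext (hκ : κ.IsRegular) (hS : (0 : Ordinal.{u}) ∉ S) :
    ∃ c P₀ next, ρ.Legal P₀ ∧ ρ.IsNext c P₀ next := by
  classical
  obtain ⟨c, P₀, hP₀, hne⟩ := ρ.exists_forced_ne_above hκ hS
  have key : ∀ (b : Iio κ.ord) (P : Approx κ (Bool × Bool × Bool)), ∃ Q, P ≤ Q ∧ b.1 < Q.len ∧
      (P.len < κ.ord → Q.len < κ.ord) ∧ (P₀ ≤ P → ρ.Legal P → ρ.Legal Q ∧
      ∀ v, ∃ γ : Iio κ.ord, b.1 < γ.1 ∧ γ.1 < Q.len ∧ ρ.Forced c Q γ v) := by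
    intro b P
    by_cases h : P₀ ≤ P ∧ ρ.Legal P
    · obtain ⟨Q, h1, h2, γ, h3, h4, h5⟩ := hne P h.1 h.2 b b.2
      obtain ⟨Q', h1', h2', γ', h3', h4', h5'⟩ := h2.exists_forced_eq hκ c b.2
      refine ⟨Q', h1.trans h1', h3'.trans h4', fun _ => h2'.len_lt, fun _ _ => ⟨h2', fun v => ?_⟩⟩
      cases v
      · exact ⟨γ', h3', h4', h5'⟩
      · exact ⟨γ, h3, h4.trans_le h1'.1, h5.mono h1'⟩
    -- At irrelevant positions nothing is forced; lengthening alone keeps the unconditional clauses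
    -- true.
    · refine ⟨⟨max P.len (Order.succ b.1), P.val⟩, P.ext_val.le (le_max_left _ _),
        (Order.lt_succ _).trans_le (le_max_right _ _), fun h => max_lt h (succ_lt_ord hκ b.2),
        fun h1 h2 => absurd ⟨h1, h2⟩ h⟩
  choose next h1 h2 h3 h4 using key
  exact ⟨c, P₀, next, hP₀, h1, h2, h3, fun b P h h' => (h4 b P h h').1,
    fun b P h h' => (h4 b P h h').2⟩

variable {c : Bool} {P₀ : Approx κ (Bool × Bool × Bool)}
  {next : Iio κ.ord → Approx κ (Bool × Bool × Bool) → Approx κ (Bool × Bool × Bool)}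

/-- The position before move `i`, when player I plays `a`. -/
noncomputable def pos (next : Iio κ.ord → Approx κ (Bool × Bool × Bool) →
    Approx κ (Bool × Bool × Bool)) (P₀ : Approx κ (Bool × Bool × Bool))
    (a : Ordinal.{u} → Iio κ.ord) (i : Ordinal.{u}) : Approx κ (Bool × Bool × Bool) :=
  Approx.run (fun j => next (a j)) P₀ i

theorem IsNext.le_pos (h : ρ.IsNext c P₀ next) (a : Ordinal.{u} → Iio κ.ord) (i : Ordinal.{u}) :
    P₀ ≤ pos next P₀ a i := Approx.le_run (fun _ _ => h.le _ _) i

theorem IsNext.next_le_pos (h : ρ.IsNext c P₀ next) (a : Ordinal.{u} → Iio κ.ord)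
    {i j : Ordinal.{u}} (hj : j < i) : next (a j) (pos next P₀ a j) ≤ pos next P₀ a i :=
  Approx.step_le_run (step := fun j => next (a j)) (fun _ _ => h.le _ _) hj

theorem IsNext.pos_len_lt (hκ : κ.IsRegular) (hP₀ : ρ.Legal P₀) (h : ρ.IsNext c P₀ next)
    (a : Ordinal.{u} → Iio κ.ord) {i : Ordinal.{u}} (hi : i < κ.ord) :
    (pos next P₀ a i).len < κ.ord :=
  Approx.run_len_lt hκ hP₀.len_lt (fun _ _ => h.len_lt _ _) hi

/-- Lengths and moves interleave: the extension made after a move is longer than that move and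
shorter than all later ones. -/
theorem IsNext.pos_len_of_isSuccLimit (h : ρ.IsNext c P₀ next) {a : Ordinal.{u} → Iio κ.ord}
    {i : Ordinal.{u}} (hi : Order.IsSuccLimit i)
    (ha : ∀ j k, j < k → k < i → (next (a j) (pos next P₀ a j)).len < (a k).1) :
    (pos next P₀ a i).len = ⨆ j : Iio i, (a j).1 := by
  have hb : ∀ j < i, (next (a j) (pos next P₀ a j)).len ≤ ⨆ j : Iio i, (a j).1 := fun j hj =>
    (ha j _ (Order.lt_succ j) (hi.succ_lt hj)).le.trans
      (Ordinal.le_iSup (fun j : Iio i => (a j).1) ⟨_, hi.succ_lt hj⟩)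
  apply le_antisymm
  · rw [pos, Approx.run_len]
    refine max_le ?_ (Ordinal.iSup_le fun j => hb j.1 j.2)
    have h0 : 0 < i := pos_iff_ne_zero.2 hi.ne_bot
    exact ((h.le_pos a 0).trans (h.le _ _)).1.trans (hb 0 h0)
  · exact Ordinal.iSup_le fun j => (h.lt_len _ _).le.trans (h.next_le_pos a j.2).1

/-- A `δ` within the length of `P₀` or of an earlier extension is covered by the legality of that
position. The only new case is the length reached at a limit stage, which is a supremum of moves and
so outside `S`. -/
theorem IsNext.legal_pos (hκ : κ.IsRegular) (hP₀ : ρ.Legal P₀) (h : ρ.IsNext c P₀ next)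
    {a : Ordinal.{u} → Iio κ.ord} {i : Ordinal.{u}} (hi : i < κ.ord)
    (ha : ∀ j k, j < k → k < i → (next (a j) (pos next P₀ a j)).len < (a k).1)
    (hS : ∀ k ≤ i, Order.IsSuccLimit k → (⨆ j : Iio k, (a j).1) ∉ S) :
    ρ.Legal (pos next P₀ a i) := by
  induction i using WellFoundedLT.induction with
  | _ i ih =>
    refine ⟨hP₀.init_le.trans (h.le_pos a i), h.pos_len_lt hκ hP₀ a hi, fun δ hδ hδi => ?_⟩
    by_cases h1 : δ ≤ P₀.len
    · exact (hP₀.diff δ hδ h1).congr (((h.le_pos a i).2.mono h1).left.comp Prod.fst)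
        (((h.le_pos a i).2.mono h1).right.comp Prod.fst)
    by_cases h2 : ∃ j < i, δ ≤ (next (a j) (pos next P₀ a j)).len
    · obtain ⟨j, hj, hδj⟩ := h2
      have hl := h.legal (a j) _ (h.le_pos a j) (ih j hj (hj.trans hi)
        (fun k l hkl hl => ha k l hkl (hl.trans hj)) fun k hk => hS k (hk.trans hj.le))
      exact (hl.diff δ hδ hδj).congr (((h.next_le_pos a hj).2.mono hδj).left.comp Prod.fst)
        (((h.next_le_pos a hj).2.mono hδj).right.comp Prod.fst)
    push Not at h1 h2
    exfalso
    rcases Ordinal.zero_or_succ_or_isSuccLimit i with rfl | ⟨k, rfl⟩ | hlim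
    · apply hδi.not_gt
      rw [pos, Approx.run_len]
      refine max_lt h1 (lt_of_le_of_lt (Ordinal.iSup_le (a := 0) fun j => ?_) (pos_of_gt h1))
      exact absurd (mem_Iio.1 j.2) (not_lt.2 zero_le)
    · apply hδi.not_gt
      rw [pos, Approx.run_len]
      refine max_lt h1 (lt_of_le_of_lt (Ordinal.iSup_le fun j => ?_) (h2 k (Order.lt_succ k)))
      rcases (Order.lt_succ_iff.1 (mem_Iio.1 j.2)).eq_or_lt with h' | h'
      · rw [h']; rfl
      · exact ((h.next_le_pos a h').trans (h.le _ _)).1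
    · have e := h.pos_len_of_isSuccLimit hlim ha
      refine hS i le_rfl hlim ?_
      have : δ = ⨆ j : Iio i, (a j).1 := by
        rw [← e]
        refine le_antisymm hδi ?_
        rw [pos, Approx.run_len]
        exact max_le h1.le (Ordinal.iSup_le fun j => (h2 j.1 j.2).le)
      rwa [← this]

/-- The position reached would be legal, so equal tails would give images whose difference is
constant on a final segment below the supremum; but both values are forced in every final segment.
-/
theorem IsNext.iSup_notMem (hκ : κ.IsRegular) (hP₀ : ρ.Legal P₀) (h : ρ.IsNext c P₀ next)
    {a : Ordinal.{u} → Iio κ.ord} {i : Ordinal.{u}} (hi : i < κ.ord) (hlim : Order.IsSuccLimit i)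
    (ha : ∀ j k, j < k → k < i → (next (a j) (pos next P₀ a j)).len < (a k).1)
    (hS : ∀ k < i, Order.IsSuccLimit k → (⨆ j : Iio k, (a j).1) ∉ S) :
    (⨆ j : Iio i, (a j).1) ∉ T c \ S := by
  rintro ⟨hT, hnS⟩
  have hS' : ∀ k ≤ i, Order.IsSuccLimit k → (⨆ j : Iio k, (a j).1) ∉ S := by
    intro k hk hkl
    rcases hk.eq_or_lt with rfl | hk
    · exact hnS
    · exact hS k hk hkl
  have hleg := h.legal_pos hκ hP₀ hi ha hS'
  have e := h.pos_len_of_isSuccLimit hlim ha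
  obtain ⟨t, ht⟩ := hleg.exists_tail hκ false
  have hlt := e ▸ hleg.len_lt
  obtain ⟨β, hβ, v, hv⟩ := (ht.es_image hleg c).1 _ hT hlt
  obtain ⟨j, hj⟩ : ∃ j : Iio i, β < (a j).1 := by
    by_contra! hcon
    exact hβ.not_ge (Ordinal.iSup_le hcon)
  have hlj := h.legal_pos hκ hP₀ (lt_trans j.2 hi) (fun k l hkl hl => ha k l hkl (lt_trans hl j.2))
    (fun k hk => hS' k (hk.trans (le_of_lt j.2)))
  obtain ⟨γ, h1, h2, h3⟩ := h.forced (a j) _ (h.le_pos a j) hlj (!v)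
  have h4 := h3 t (ht.ext.mono (h.next_le_pos a j.2)) ht.left_mem ht.right_mem
  have h5 := hv γ (hj.trans h1) (h2.trans_le (e ▸ (h.next_le_pos a j.2).1))
  rw [h5] at h4
  simp at h4

/-- From a reduction one obtains a strategy of player II in the cub-game such that the suprema
of the plays avoid `T c \ S` for a fixed `c`, provided that the suprema of their proper initial
segments avoid `S`. -/
theorem exists_strategy (hκ : κ.IsRegular) (ρ : PairReduction κ S T) (hS : (0 : Ordinal.{u}) ∉ S) :
    ∃ (c : Bool) (σ : StrategyII κ), ∀ lam ∈ reg κ, ∀ a : Iio lam.ord → Iio κ.ord,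
      (∀ i j, j < i → a j < a i ∧ σ.reply a j < a i) →
      (∀ i, a i < σ.reply a i) ∧
      ((∀ i : Iio lam.ord, Order.IsSuccLimit i.1 →
          (⨆ j : Iio i.1, (a ⟨j.1, lt_trans (mem_Iio.1 j.2) (mem_Iio.1 i.2)⟩ : Ordinal.{u})) ∉ S) →
        (⨆ i, (a i : Ordinal.{u})) ∉ T c \ S) := by
  obtain ⟨c, P₀, next, hP₀, h⟩ := ρ.exists_isNext hκ hS
  refine ⟨c, lengthStrategy hκ next P₀, fun lam hlam a ha => ?_⟩
  let b : Ordinal.{u} → Iio κ.ord := fun j => if hj : j < lam.ord then a ⟨j, hj⟩ else ⟨0, hκ.ord_pos⟩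
  have hlκ : lam.ord < κ.ord := Cardinal.ord_lt_ord.2 hlam.2
  have hab : a = fun i : Iio lam.ord => b i := by
    funext i
    have : i.1 < lam.ord := i.2
    simp only [b, dif_pos this]
  have hreply : ∀ i : Iio lam.ord, ((lengthStrategy hκ next P₀).reply a i : Ordinal.{u}) =
      (next (b i) (pos next P₀ b i)).len := by
    intro i
    rw [hab, reply_lengthStrategy, coe_toIio]
    · rfl
    · exact h.len_lt _ _ (h.pos_len_lt hκ hP₀ b (lt_trans i.2 hlκ))
  have hb : ∀ i : Iio lam.ord, a i = b i := fun i => congrFun hab i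
  refine ⟨fun i => ?_, fun hlim => ?_⟩
  · rw [← Subtype.coe_lt_coe, hreply, hb]
    exact h.lt_len _ _
  · have := h.iSup_notMem hκ hP₀ hlκ (Cardinal.isSuccLimit_ord hlam.1.aleph0_le) (a := b) ?_ ?_
    · simpa only [hb] using this
    · intro j k hjk hk
      have := (ha ⟨k, hk⟩ ⟨j, hjk.trans hk⟩ hjk).2
      rwa [← Subtype.coe_lt_coe, hreply, hb] at this
    · intro k hk hkl
      have := hlim ⟨k, hk⟩ hkl
      simpa only [hb] using this

end PairReduction

end CubGames

namespace CubGames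

variable {κ : Cardinal.{u}}

/-! ### Cub sets -/

/-- The nonzero ordinals below `κ` closed under `G`. -/
def closurePoints (κ : Cardinal.{u}) (G : Ordinal.{u} → Ordinal.{u}) : Set Ordinal.{u} :=
  {δ | δ < κ.ord ∧ δ ≠ 0 ∧ ∀ x < δ, G x < δ}

theorem iSup_nat_lt_ord (hκ : κ.IsRegular) (hκ' : ℵ₀ < κ) {f : ℕ → Ordinal.{u}}
    (hf : ∀ n, f n < κ.ord) : ⨆ n, f n < κ.ord := by
  apply Ordinal.lift_iSup_lt_of_lt_cof _ hf
  rw [← Ordinal.lift_cof, hκ.cof_ord, Cardinal.mk_nat, Cardinal.lift_aleph0]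
  simpa using hκ'

theorem exists_closurePoint (hκ : κ.IsRegular) (hκ' : ℵ₀ < κ) {G : Ordinal.{u} → Ordinal.{u}}
    (hG : ∀ x < κ.ord, G x < κ.ord) {ξ : Ordinal.{u}} (hξ : ξ < κ.ord) :
    ∃ δ ∈ closurePoints κ G, ξ < δ := by
  let F : Ordinal.{u} → Ordinal.{u} := fun x => Order.succ (⨆ y : Iio x, G y.1)
  let s : ℕ → Ordinal.{u} := fun n => F^[n] (Order.succ ξ)
  have hsucc : ∀ n, s (n + 1) = F (s n) := fun n => Function.iterate_succ_apply' F n _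
  have hs : ∀ n, s n < κ.ord := by
    intro n
    induction n with
    | zero => exact succ_lt_ord hκ hξ
    | succ n ih =>
      rw [hsucc]
      exact succ_lt_ord hκ (iSup_Iio_lt_ord hκ ih fun y => hG _ (lt_trans y.2 ih))
  have hle : ∀ n, s n ≤ ⨆ n, s n := Ordinal.le_iSup s
  have hξδ : ξ < ⨆ n, s n := (Order.lt_succ ξ).trans_le (hle 0)
  refine ⟨⨆ n, s n, ⟨iSup_nat_lt_ord hκ hκ' hs, (pos_of_gt hξδ).ne', fun x hx => ?_⟩, hξδ⟩
  obtain ⟨n, hn⟩ := Ordinal.lt_iSup_iff.1 hx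
  refine lt_of_lt_of_le ?_ (hle (n + 1))
  rw [hsucc]
  exact Order.lt_succ_iff.2 (Ordinal.le_iSup (fun y : Iio (s n) => G y.1) ⟨x, hn⟩)

theorem isCub_closurePoints (hκ : κ.IsRegular) (hκ' : ℵ₀ < κ) {G : Ordinal.{u} → Ordinal.{u}}
    (hG : ∀ x < κ.ord, G x < κ.ord) : IsCub κ (closurePoints κ G) := by
  refine ⟨fun δ h => h.1, fun lam hlam s _ hs => ⟨?_, ?_, fun x hx => ?_⟩, fun ξ hξ => ?_⟩
  · exact iSup_Iio_lt_ord hκ (Cardinal.ord_lt_ord.2 hlam.2) fun i => (hs i).1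
  · have h0 : (0 : Ordinal.{u}) < lam.ord := hlam.1.ord_pos
    exact ((pos_iff_ne_zero.2 (hs ⟨0, h0⟩).2.1).trans_le (Ordinal.le_iSup s _)).ne'
  · obtain ⟨i, hi⟩ := Ordinal.lt_iSup_iff.1 hx
    exact ((hs i).2.2 x hi).trans_le (Ordinal.le_iSup s _)
  · obtain ⟨δ, h, h'⟩ := exists_closurePoint hκ hκ' hG hξ
    exact ⟨δ, h, h', h.1⟩

theorem aleph0_mem_reg (hκ' : ℵ₀ < κ) : ℵ₀ ∈ reg κ := ⟨isRegular_aleph0, hκ'⟩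

theorem cof_iSup_of_strictMono {lam : Cardinal.{u}} (h : lam.IsRegular)
    {s : Iio lam.ord → Ordinal.{u}} (hs : StrictMono s) : (⨆ i, s i).cof = lam := by
  rw [Ordinal.cof_iSup_Iio hs (Cardinal.isSuccLimit_ord h.aleph0_le).isSuccPrelimit, h.cof_ord]

/-- This lets an `ω`-stationary set be met at closure points of countable cofinality, where ladders
of type `ω` exist. -/
theorem isLamCub_closurePoints (hκ : κ.IsRegular) (hκ' : ℵ₀ < κ) {G : Ordinal.{u} → Ordinal.{u}}
    (hG : ∀ x < κ.ord, G x < κ.ord) : IsLamCub κ ℵ₀ (closurePoints κ G ∩ cofEq κ ℵ₀) := by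
  have hcub := isCub_closurePoints hκ hκ' hG
  refine ⟨fun δ h => h.1.1, fun s hs hsC => ?_, fun ξ hξ => ?_⟩
  · have := hcub.2.1 ℵ₀ (aleph0_mem_reg hκ') s hs fun i => (hsC i).1
    exact ⟨this, this.1, cof_iSup_of_strictMono isRegular_aleph0 hs⟩
  · have hex : ∀ x : Iio κ.ord, ∃ y : Iio κ.ord, y.1 ∈ closurePoints κ G ∧ x < y := by
      intro x
      obtain ⟨y, h1, h2⟩ := exists_closurePoint hκ hκ' hG x.2
      exact ⟨⟨y, h1.1⟩, h1, h2⟩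
    choose nx h1 h2 using hex
    let s : ℕ → Iio κ.ord := fun n => Nat.rec (nx ⟨ξ, hξ⟩) (fun _ x => nx x) n
    have hmono : StrictMono s := strictMono_nat_of_lt_succ fun n => h2 (s n)
    have hmem : ∀ n, (s n).1 ∈ closurePoints κ G := by
      intro n
      cases n with
      | zero => exact h1 _
      | succ n => exact h1 _
    have hξs : ξ < ⨆ n, (s n).1 :=
      lt_of_lt_of_le (h2 ⟨ξ, hξ⟩) (Ordinal.le_iSup (fun n => (s n).1) 0)
    have hκs := iSup_nat_lt_ord hκ hκ' (f := fun n => (s n).1) fun n => (s n).2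
    refine ⟨⨆ n, (s n).1, ⟨⟨hκs, (pos_of_gt hξs).ne', fun x hx => ?_⟩, hκs, ?_⟩, hξs, hκs⟩
    · obtain ⟨n, hn⟩ := Ordinal.lt_iSup_iff.1 hx
      exact ((hmem n).2.2 x hn).trans_le (Ordinal.le_iSup (fun n => (s n).1) n)
    · have h := Ordinal.lift_cof_iSup (f := fun n => (s n).1) fun m n hmn => hmono hmn
      rw [Order.cof_nat] at h
      simpa using h

/-- A stationary set of ordinals of cofinality `lam` meets all `lam`-cub sets. -/
theorem Stationary.inter_isLamCub_nonempty (hκ : κ.IsRegular) (hκ' : ℵ₀ < κ) {lam : Cardinal.{u}}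
    (hlam : lam.IsRegular) {X C : Set Ordinal.{u}} (hX : Stationary κ (X ∩ cofEq κ lam))
    (hC : IsLamCub κ lam C) : (X ∩ C).Nonempty := by
  classical
  let G : Ordinal.{u} → Ordinal.{u} := fun x =>
    if h : ∃ y ∈ C, x < y ∧ y < κ.ord then h.choose else 0
  have hGs : ∀ x < κ.ord, G x ∈ C ∧ x < G x ∧ G x < κ.ord := by
    intro x hx
    have h := hC.2.2 x hx
    simp only [G, dif_pos h]
    exact h.choose_spec
  obtain ⟨δ, ⟨hδX, hδκ, hδc⟩, -, hδ0, hδG⟩ :=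
    hX _ (isCub_closurePoints hκ hκ' fun x hx => (hGs x hx).2.2)
  obtain ⟨f, hf⟩ := Ordinal.exists_isFundamentalSeq (o := δ) (a := lam.ord) (by rw [hδc])
  have hsup : ⨆ i, (f i).1 = δ := hf.iSup_eq
    ((Ordinal.one_lt_omega0).trans_le (Cardinal.omega0_le_ord.2 hlam.aleph0_le))
  have hl := Cardinal.isSuccLimit_ord hlam.aleph0_le
  -- interleave the cofinal sequence with elements of `C`
  let s : Ordinal.{u} → Ordinal.{u} := fun i => WellFoundedLT.fix (motive := fun _ => Ordinal.{u})
    (fun i ih => G (max (if h : i < lam.ord then (f ⟨i, h⟩).1 else 0) (⨆ j : Iio i, ih j.1 j.2))) i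
  have hs : ∀ i, s i = G (max (if h : i < lam.ord then (f ⟨i, h⟩).1 else 0)
      (⨆ j : Iio i, s j.1)) := fun i => WellFoundedLT.fix_eq _ i
  have hsδ : ∀ i < lam.ord, max (if h : i < lam.ord then (f ⟨i, h⟩).1 else 0)
      (⨆ j : Iio i, s j.1) < δ := by
    intro i
    induction i using WellFoundedLT.induction with
    | _ i ih =>
      intro hi
      refine max_lt (by rw [dif_pos hi]; exact (f _).2) ?_
      refine iSup_Iio_lt_of_card_lt_cof (by rw [hδc]; exact Cardinal.lt_ord.1 hi) fun j => ?_
      rw [hs]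
      exact hδG _ (ih j.1 j.2 (lt_trans j.2 hi))
  have hmax : ∀ i < lam.ord, max (if h : i < lam.ord then (f ⟨i, h⟩).1 else 0)
      (⨆ j : Iio i, s j.1) < s i := by
    intro i hi
    rw [hs i]
    exact (hGs _ ((hsδ i hi).trans hδκ)).2.1
  have hlub : ⨆ i : Iio lam.ord, s i.1 = δ := by
    apply le_antisymm
    · refine Ordinal.iSup_le fun i => ?_
      rw [hs]
      exact (hδG _ (hsδ i.1 i.2)).le
    · rw [← hsup]
      refine Ordinal.iSup_le fun i => ?_
      refine le_trans ?_ (Ordinal.le_iSup (fun i : Iio lam.ord => s i.1) i)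
      have := (le_max_left _ _).trans_lt (hmax i.1 i.2)
      rw [dif_pos (mem_Iio.1 i.2)] at this
      exact this.le
  refine ⟨δ, hδX, hlub ▸ hC.2.1 (fun i => s i.1) (fun i j hij => ?_) fun i => ?_⟩
  · refine lt_of_le_of_lt ?_ ((le_max_right _ _).trans_lt (hmax j.1 j.2))
    exact Ordinal.le_iSup (fun k : Iio j.1 => s k.1) ⟨i.1, hij⟩
  · rw [hs]
    exact (hGs _ ((hsδ i.1 i.2).trans hδκ)).1

/-! ### Plays along ladders -/

/-- A sequence of unbounded sets which cohere at the limit points, all of which have small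
cofinality. -/
structure IsLadderSystem (κ μ : Cardinal.{u}) (T : Set Ordinal.{u})
    (C : Ordinal.{u} → Set Ordinal.{u}) : Prop where
  subset_cofEq : T ⊆ cofEq κ μ
  subset_Iio : ∀ α ∈ T, C α ⊆ Iio α
  unbounded : ∀ α ∈ T, UnboundedIn α (C α)
  cof_lt : ∀ α ∈ T, ∀ β ∈ limBelow α (C α), β.cof < μ
  coherent : ∀ α ∈ T, ∀ β ∈ limBelow α (C α), C β = Iio β ∩ C α

/-- An initial segment of a ladder, coded by a limit point and finitely many further points. -/
def ladderTrace (C : Ordinal.{u} → Set Ordinal.{u}) {x : Ordinal.{u}}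
    (p : Iio (Order.succ x) × Finset (Iio x)) : Set Ordinal.{u} :=
  (C p.1.1 ∩ Iio p.1.1) ∪ (fun y : Iio x => y.1) '' (p.2 : Set (Iio x))

/-- Only finitely many elements of `C α` lie between the last limit point `β ≤ x` (or 0) and `x`,
and below `β` coherence replaces `C α` by `C β`, which does not mention `α`. -/
theorem IsLadderSystem.exists_trace {μ : Cardinal.{u}} {T : Set Ordinal.{u}}
    {C : Ordinal.{u} → Set Ordinal.{u}} (h : IsLadderSystem κ μ T C) {α x : Ordinal.{u}}
    (hα : α ∈ T) (hx : x < α) :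
    ∃ p : Iio (Order.succ x) × Finset (Iio x), C α ∩ Iio x = ladderTrace C p := by
  have key : ∀ x < α, ∃ β ≤ x, (β = 0 ∨ β ∈ limBelow α (C α)) ∧ (C α ∩ Ico β x).Finite := by
    intro x
    induction x using WellFoundedLT.induction with
    | _ x ih =>
      intro hx
      by_cases hu : UnboundedIn x (C α)
      · by_cases hx0 : x = 0
        · exact ⟨x, le_rfl, Or.inl hx0, by simp⟩
        · exact ⟨x, le_rfl, Or.inr ⟨hx, hx0, hu⟩, by simp⟩
      · unfold UnboundedIn at hu
        push Not at hu
        obtain ⟨y, hyx, hy⟩ := hu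
        obtain ⟨β, hβ, hβ', hfin⟩ := ih y hyx (hyx.trans hx)
        refine ⟨β, hβ.trans hyx.le, hβ', (hfin.insert y).subset ?_⟩
        rintro z ⟨hz, hz1, hz2⟩
        rcases lt_trichotomy z y with h' | h' | h'
        · exact Or.inr ⟨hz, hz1, h'⟩
        · exact Or.inl h'
        · exact absurd hz2 (hy z hz h').not_gt
  obtain ⟨β, hβ, hβ', hfin⟩ := key x hx
  have hfin' : {y : Iio x | y.1 ∈ C α ∩ Ico β x}.Finite :=
    hfin.preimage Subtype.val_injective.injOn
  refine ⟨(⟨β, Order.lt_succ_iff.2 hβ⟩, hfin'.toFinset), ?_⟩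
  have hCβ : C β ∩ Iio β = C α ∩ Iio β := by
    rcases hβ' with rfl | hβ'
    · simp
    · rw [h.coherent α hα β hβ']
      ext z
      simp only [mem_inter_iff]
      tauto
  simp only [ladderTrace, hCβ]
  ext z
  simp only [mem_inter_iff, mem_union, mem_image, Finite.coe_toFinset, mem_ofPred_eq, mem_Iio,
    mem_Ico]
  constructor
  · rintro ⟨h1, h2⟩
    rcases lt_or_ge z β with h' | h'
    · exact Or.inl ⟨h1, h'⟩
    · exact Or.inr ⟨⟨z, h2⟩, ⟨h1, h', h2⟩, rfl⟩
  · rintro (⟨h1, h2⟩ | ⟨y, ⟨h1, -, h2⟩, rfl⟩)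
    · exact ⟨h1, h2.trans_le hβ⟩
    · exact ⟨h1, h2⟩

/-- Finite subsets keep the count below `κ`; coding traces by arbitrary subsets of `x` would not do
so in general. -/
theorem mk_trace_lt (hκ : κ.IsRegular) (hκ' : ℵ₀ < κ) {x : Ordinal.{u}} (hx : x < κ.ord) :
    #((Iio (Order.succ x) × Finset (Iio x)) × Iio x) < Cardinal.lift.{u + 1} κ := by
  have hI : ∀ y < κ.ord, #(Iio y) < Cardinal.lift.{u + 1} κ := fun y hy => by
    rw [Cardinal.mk_Iio_ordinal]
    exact Cardinal.lift_lt.2 (Cardinal.lt_ord.1 hy)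
  have h0 : ℵ₀ < Cardinal.lift.{u + 1} κ := by simpa using hκ'
  have hF : #(Finset (Iio x)) < Cardinal.lift.{u + 1} κ := by
    rcases finite_or_infinite (Iio x) with h | h
    · exact (Cardinal.lt_aleph0_of_finite _).trans h0
    · rw [Cardinal.mk_finset_of_infinite]
      exact hI x hx
  rw [Cardinal.mk_prod, Cardinal.mk_prod]
  simp only [Cardinal.lift_id]
  exact Cardinal.mul_lt_of_lt h0.le
    (Cardinal.mul_lt_of_lt h0.le (hI _ (succ_lt_ord hκ hx)) hF) (hI x hx)

/-- Suprema of ordinals over all traces below a bound need a small index type. -/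
instance small_finset {α : Type v} [Small.{w} α] : Small.{w} (Finset α) :=
  small_of_injective (Finset.coe_injective (α := α))

/-- The play against `σ` in which player I always chooses the least possible element of `D`. -/
noncomputable def greedy (hκ : κ.IsRegular) (σ : StrategyII κ) (D : Set Ordinal.{u})
    (i : Ordinal.{u}) : Ordinal.{u} :=
  sInf {x ∈ D | ∀ j : Iio i, greedy hκ σ D j.1 < x ∧
    (σ j.1 fun k : Iic j.1 => toIio hκ (greedy hκ σ D k.1)).1 < x}
termination_by i
decreasing_by
  · exact j.2
  · exact lt_of_le_of_lt (mem_Iic.1 k.2) (mem_Iio.1 j.2)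

/-- The reply of `σ` in the play `greedy`. -/
noncomputable def greedyReply (hκ : κ.IsRegular) (σ : StrategyII κ) (D : Set Ordinal.{u})
    (j : Ordinal.{u}) : Iio κ.ord :=
  σ j fun k : Iic j => toIio hκ (greedy hκ σ D k.1)

/-- The legal moves of player I in `D`. -/
def greedySet (hκ : κ.IsRegular) (σ : StrategyII κ) (D : Set Ordinal.{u}) (i : Ordinal.{u}) :
    Set Ordinal.{u} :=
  {x ∈ D | ∀ j < i, greedy hκ σ D j < x ∧ (greedyReply hκ σ D j).1 < x}

theorem greedy_eq (hκ : κ.IsRegular) (σ : StrategyII κ) (D : Set Ordinal.{u}) (i : Ordinal.{u}) :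
    greedy hκ σ D i = sInf (greedySet hκ σ D i) := by
  rw [greedy]
  congr 1
  ext x
  simp only [greedySet, mem_ofPred_eq, Subtype.forall, mem_Iio, greedyReply]

theorem greedyReply_congr {hκ : κ.IsRegular} {σ : StrategyII κ} {D D' : Set Ordinal.{u}}
    {i : Ordinal.{u}} (h : ∀ j ≤ i, greedy hκ σ D' j = greedy hκ σ D j) :
    greedyReply hκ σ D' i = greedyReply hκ σ D i := by
  unfold greedyReply
  congr 1
  funext k
  rw [h k.1 k.2]

/-- The greedy play is local: while its moves stay below `x`, it sees only `D ∩ Iio x`. Requiring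
them to be legal excludes the default value `sInf ∅`. -/
theorem greedy_congr {hκ : κ.IsRegular} {σ : StrategyII κ} {D D' : Set Ordinal.{u}}
    {x i : Ordinal.{u}} (hDD : D ∩ Iio x = D' ∩ Iio x)
    (h : ∀ j ≤ i, greedy hκ σ D j ∈ greedySet hκ σ D j ∧ greedy hκ σ D j < x) :
    ∀ j ≤ i, greedy hκ σ D' j = greedy hκ σ D j := by
  intro j
  induction j using WellFoundedLT.induction with
  | _ j ih =>
    intro hj
    have hgr : ∀ k < j, greedy hκ σ D' k = greedy hκ σ D k := fun k hk => ih k hk (hk.le.trans hj)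
    have hset : ∀ z < x, (z ∈ greedySet hκ σ D' j ↔ z ∈ greedySet hκ σ D j) := by
      intro z hz
      have hzD : z ∈ D ↔ z ∈ D' := by
        have := Set.ext_iff.1 hDD z
        simpa [hz] using this
      refine and_congr hzD.symm (forall₂_congr fun k hk => ?_)
      rw [hgr k hk, greedyReply_congr fun l hl => hgr l (hl.trans_lt hk)]
    have h1 := h j hj
    have h2 := (hset _ h1.2).2 h1.1
    have h3 : greedy hκ σ D' j ≤ greedy hκ σ D j := by
      rw [greedy_eq]
      exact csInf_le' h2
    refine h3.antisymm ?_
    have h4 : greedy hκ σ D' j ∈ greedySet hκ σ D' j := by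
      rw [greedy_eq]
      exact csInf_mem ⟨_, h2⟩
    conv_lhs => rw [greedy_eq]
    exact csInf_le' ((hset _ (h3.trans_lt h1.2)).1 h4)

/-- For each strategy `σ` of player II and cub many `α`, for which there is a ladder, there is a
play along the ladder of `α` with supremum `α` in which player II follows `σ`. -/
theorem IsLadderSystem.exists_play {μ : Cardinal.{u}} {T : Set Ordinal.{u}}
    {C : Ordinal.{u} → Set Ordinal.{u}} (h : IsLadderSystem κ μ T C) (hκ : κ.IsRegular)
    (hκ' : ℵ₀ < κ) (hμ : μ ∈ reg κ) (σ : StrategyII κ) :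
    ∃ G : Ordinal.{u} → Ordinal.{u}, (∀ x < κ.ord, G x < κ.ord) ∧
      ∀ α ∈ T, α ∈ closurePoints κ G → ∃ a : Iio μ.ord → Iio κ.ord,
        (∀ i j, j < i → a j < a i ∧ σ.reply a j < a i) ∧ (⨆ i, (a i : Ordinal.{u})) = α ∧
        ∀ i : Iio μ.ord, Order.IsSuccLimit i.1 →
          (⨆ j : Iio i.1, (a ⟨j.1, lt_trans (mem_Iio.1 j.2) (mem_Iio.1 i.2)⟩ : Ordinal.{u})) ∈
            limBelow α (C α) := by
  -- `G x` bounds the replies at stages before `x` in greedy plays along any of the possible traces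
  -- below `x`.
  refine ⟨fun x => ⨆ p : (Iio (Order.succ x) × Finset (Iio x)) × Iio x,
    (greedyReply hκ σ (ladderTrace C p.1) p.2.1).1, fun x hx => ?_, fun α hα hαG => ?_⟩
  · apply Ordinal.lift_iSup_lt_of_lt_cof
    · rw [← Ordinal.lift_cof, hκ.cof_ord]
      rw [Cardinal.lift_id'.{u, u + 1}]
      exact mk_trace_lt hκ hκ' hx
    · exact fun p => (greedyReply hκ σ _ _).2
  have hαμ := (h.subset_cofEq hα).2
  -- The bound `i ≤ greedy i` serves to make the stage `i` an admissible index in `G z` for `z`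
  -- above the move.
  have main : ∀ i < μ.ord, greedy hκ σ (C α) i ∈ greedySet hκ σ (C α) i ∧
      i ≤ greedy hκ σ (C α) i ∧ (greedyReply hκ σ (C α) i).1 < α := by
    intro i
    induction i using WellFoundedLT.induction with
    | _ i ih =>
      intro hi
      have hlt : ∀ j < i, greedy hκ σ (C α) j < α := fun j hj =>
        h.subset_Iio α hα (ih j hj (hj.trans hi)).1.1
      have hsup : ⨆ j : Iio i, max (greedy hκ σ (C α) j.1) (greedyReply hκ σ (C α) j.1).1 < α :=
        iSup_Iio_lt_of_card_lt_cof (by rw [hαμ]; exact Cardinal.lt_ord.1 hi) fun j =>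
          max_lt (hlt j.1 j.2) (ih j.1 j.2 (lt_trans j.2 hi)).2.2
      obtain ⟨y, hy, hy1, -⟩ := h.unbounded α hα _ hsup
      have hyS : y ∈ greedySet hκ σ (C α) i := by
        refine ⟨hy, fun j hj => ?_⟩
        have := (Ordinal.le_iSup (fun j : Iio i => max (greedy hκ σ (C α) j.1)
          (greedyReply hκ σ (C α) j.1).1) ⟨j, hj⟩).trans_lt hy1
        exact max_lt_iff.1 this
      have hmem : greedy hκ σ (C α) i ∈ greedySet hκ σ (C α) i := by
        rw [greedy_eq]
        exact csInf_mem ⟨_, hyS⟩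
      have hle : i ≤ greedy hκ σ (C α) i :=
        le_of_forall_lt fun j hj => (ih j hj (hj.trans hi)).2.1.trans_lt (hmem.2 j hj).1
      refine ⟨hmem, hle, ?_⟩
      have hgα : greedy hκ σ (C α) i < α := h.subset_Iio α hα hmem.1
      obtain ⟨z, -, hz1, hz2⟩ := h.unbounded α hα _ hgα
      obtain ⟨p, hp⟩ := h.exists_trace hα hz2
      have hD : C α ∩ Iio z = (C α ∩ Iio z) ∩ Iio z := by
        rw [inter_assoc, inter_self]
      have hcongr := greedy_congr (hκ := hκ) (σ := σ) (i := i) hD fun j hj => by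
        rcases hj.eq_or_lt with rfl | hj
        · exact ⟨hmem, hz1⟩
        · exact ⟨(ih j hj (hj.trans hi)).1, (hmem.2 j hj).1.trans hz1⟩
      rw [← greedyReply_congr hcongr, hp]
      refine lt_of_le_of_lt ?_ (hαG.2.2 z hz2)
      exact Ordinal.le_iSup (fun p : (Iio (Order.succ z) × Finset (Iio z)) × Iio z =>
        (greedyReply hκ σ (ladderTrace C p.1) p.2.1).1) (p, ⟨i, hle.trans_lt hz1⟩)
  have hgκ : ∀ i < μ.ord, greedy hκ σ (C α) i < κ.ord := fun i hi =>
    (h.subset_Iio α hα (main i hi).1.1 : _ < α).trans hαG.1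
  have hcoe : ∀ i : Iio μ.ord, (toIio hκ (greedy hκ σ (C α) i.1) : Ordinal.{u}) =
      greedy hκ σ (C α) i.1 := fun i => coe_toIio hκ (hgκ i.1 i.2)
  have hlim := Cardinal.isSuccLimit_ord hμ.1.aleph0_le
  have hunb : ∀ i ≤ μ.ord, Order.IsSuccLimit i →
      (⨆ j : Iio i, greedy hκ σ (C α) j.1) ≠ 0 ∧
      UnboundedIn (⨆ j : Iio i, greedy hκ σ (C α) j.1) (C α) := by
    intro i hi hil
    have hlt : ∀ j (hj : j < i), greedy hκ σ (C α) j < ⨆ j : Iio i, greedy hκ σ (C α) j.1 := by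
      intro j hj
      have hj' := hil.succ_lt hj
      exact ((main _ (hj'.trans_le hi)).1.2 j (Order.lt_succ j)).1.trans_le
        (Ordinal.le_iSup (fun j : Iio i => greedy hκ σ (C α) j.1) ⟨_, hj'⟩)
    refine ⟨(pos_of_gt (hlt 0 (pos_iff_ne_zero.2 hil.ne_bot))).ne', fun β hβ => ?_⟩
    obtain ⟨j, hj⟩ := Ordinal.lt_iSup_iff.1 hβ
    exact ⟨_, (main _ (lt_of_lt_of_le j.2 hi)).1.1, hj, hlt j.1 j.2⟩
  have hstrict : StrictMono fun i : Iio μ.ord => greedy hκ σ (C α) i.1 := fun i j hij =>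
    ((main j.1 j.2).1.2 i.1 hij).1
  refine ⟨fun i => toIio hκ (greedy hκ σ (C α) i.1), fun i j hij => ?_, ?_, fun i hi => ?_⟩
  · rw [← Subtype.coe_lt_coe, ← Subtype.coe_lt_coe, hcoe, hcoe]
    exact (main i.1 i.2).1.2 j.1 hij
  · simp only [hcoe]
    -- A supremum below `α` would be a limit point of `C α` of cofinality `μ`, against `cof_lt`.
    by_contra hne
    have hlt : ⨆ i : Iio μ.ord, greedy hκ σ (C α) i.1 < α :=
      lt_of_le_of_ne (Ordinal.iSup_le fun i => (h.subset_Iio α hα (main i.1 i.2).1.1).le) hne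
    have := h.cof_lt α hα _ ⟨hlt, hunb _ le_rfl hlim⟩
    rw [cof_iSup_of_strictMono hμ.1 hstrict] at this
    exact this.false
  · have e : ∀ j : Iio i.1, (toIio hκ (greedy hκ σ (C α) j.1) : Ordinal.{u}) =
      greedy hκ σ (C α) j.1 := fun j => coe_toIio hκ (hgκ j.1 (lt_trans j.2 i.2))
    simp only [e]
    refine ⟨?_, hunb _ (le_of_lt i.2) hi⟩
    exact iSup_Iio_lt_of_card_lt_cof (by rw [hαμ]; exact Cardinal.lt_ord.1 i.2) fun j =>
      h.subset_Iio α hα (main j.1 (lt_trans j.2 i.2)).1.1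

/-- Ordinals of countable cofinality have ladders without limit points. -/
theorem exists_isLadderSystem_aleph0 (κ : Cardinal.{u}) :
    ∃ C : Ordinal.{u} → Set Ordinal.{u}, IsLadderSystem κ ℵ₀ (cofEq κ ℵ₀) C := by
  have key : ∀ α ∈ cofEq κ ℵ₀, ∃ C : Set Ordinal.{u}, C ⊆ Iio α ∧ UnboundedIn α C ∧
      ∀ β, β ∉ limBelow α C := by
    rintro α ⟨-, hα⟩
    obtain ⟨f, hf⟩ := Ordinal.exists_isFundamentalSeq (o := α) (a := ω) (by rw [hα, ord_aleph0])
    have hsup : ⨆ i, (f i).1 = α := hf.iSup_eq Ordinal.one_lt_omega0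
    refine ⟨range fun i => (f i).1, ?_, fun β hβ => ?_, ?_⟩
    · rintro _ ⟨i, rfl⟩
      exact (f i).2
    · obtain ⟨i, hi⟩ := Ordinal.lt_iSup_iff.1 (hsup.symm ▸ hβ)
      exact ⟨_, ⟨i, rfl⟩, hi, (f i).2⟩
    · rintro β ⟨hβα, hβ0, hβ⟩
      -- A limit point `β < α` would lie above all terms of the cofinal sequence, one after the
      -- other.
      have hn : ∀ n : ℕ, (f ⟨n, Ordinal.natCast_lt_omega0 n⟩).1 < β := by
        intro n
        induction n with
        | zero =>
          obtain ⟨_, ⟨i, rfl⟩, -, hi⟩ := hβ 0 (pos_iff_ne_zero.2 hβ0)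
          refine lt_of_le_of_lt (hf.strictMono.monotone ?_) hi
          simp [← Subtype.coe_le_coe]
        | succ n ih =>
          obtain ⟨_, ⟨i, rfl⟩, hi', hi⟩ := hβ _ ih
          refine lt_of_le_of_lt (hf.strictMono.monotone ?_) hi
          have := hf.strictMono.lt_iff_lt.1 hi'
          rw [← Subtype.coe_le_coe]
          push_cast
          exact Order.add_one_le_of_lt this
      obtain ⟨i, hi⟩ := Ordinal.lt_iSup_iff.1 (hsup.symm ▸ hβα)
      obtain ⟨n, hn'⟩ := Ordinal.lt_omega0.1 i.2
      have : i = ⟨n, Ordinal.natCast_lt_omega0 n⟩ := Subtype.ext hn'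
      rw [this] at hi
      exact hi.not_gt (hn n)
  choose! C h1 h2 h3 using key
  exact ⟨C, subset_rfl, h1, h2, fun α hα β hβ => absurd hβ (h3 α hα β),
    fun α hα β hβ => absurd hβ (h3 α hα β)⟩

/-- A square sequence is a system of ladders. -/
theorem IsSquareSeq.isLadderSystem {μ : Cardinal.{u}} {C : Ordinal.{u} → Set Ordinal.{u}}
    (h : IsSquareSeq κ μ C) (hμ : μ ∈ reg κ) (hμ' : ℵ₀ < μ) :
    IsLadderSystem κ μ (cofEq κ μ) C := by
  have hsub : cofEq κ μ ⊆ cofLe κ μ := fun α hα =>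
    mem_iUnion₂.2 ⟨μ, ⟨hμ, le_rfl⟩, hα⟩
  refine ⟨subset_rfl, fun α hα => (h α (hsub hα)).1.1, fun α hα => (h α (hsub hα)).1.2.2,
    fun α hα β hβ => ?_, fun α hα β hβ => ((h α (hsub hα)).2.1 β hβ).2⟩
  obtain ⟨-, hunb⟩ := (h α (hsub hα)).1.2
  obtain ⟨hβle, hβeq⟩ := (h α (hsub hα)).2.1 β hβ
  -- Cofinality at least `μ` would give `C β` at least `μ` elements. But `C β` is contained in `C δ`
  -- for a later limit point `δ` with `cof δ = ω < μ`, and `C δ` has fewer than `μ` elements.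
  by_contra! hcof
  -- the next limit point `δ` of `C α` has countable cofinality
  choose! nx h1 h2 h3 using hunb
  let s : ℕ → Ordinal.{u} := fun n => Nat.rec (nx β) (fun _ x => nx x) n
  have hs : ∀ n, s n < α := by
    intro n
    induction n with
    | zero => exact h3 _ hβ.1
    | succ n ih => exact h3 _ ih
  have hsC : ∀ n, s n ∈ C α := by
    intro n
    cases n with
    | zero => exact h1 _ hβ.1
    | succ n => exact h1 _ (hs n)
  have hmono : StrictMono s := strictMono_nat_of_lt_succ fun n => h2 _ (hs n)
  have hβδ : β < ⨆ n, s n := (h2 _ hβ.1).trans_le (Ordinal.le_iSup s 0)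
  have hδα : ⨆ n, s n < α := by
    apply Ordinal.lift_iSup_lt_of_lt_cof _ hs
    rw [← Ordinal.lift_cof, hα.2, Cardinal.mk_nat, Cardinal.lift_aleph0]
    simpa using hμ'
  have hδcof : (⨆ n, s n).cof = ℵ₀ := by
    have h := Ordinal.lift_cof_iSup hmono
    rw [Order.cof_nat] at h
    simpa using h
  have hδ : (⨆ n, s n) ∈ limBelow α (C α) := by
    refine ⟨hδα, (pos_of_gt hβδ).ne', fun x hx => ?_⟩
    obtain ⟨n, hn⟩ := Ordinal.lt_iSup_iff.1 hx
    exact ⟨s n, hsC n, hn, (hmono (Nat.lt_succ_self n)).trans_le (Ordinal.le_iSup s (n + 1))⟩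
  obtain ⟨hδle, hδeq⟩ := (h α (hsub hα)).2.1 _ hδ
  have hcard := (h _ hδle).2.2 (hδcof ▸ hμ')
  have hsubset : C β ⊆ C (⨆ n, s n) := by
    rw [hβeq, hδeq]
    exact inter_subset_inter_left _ (Iio_subset_Iio hβδ.le)
  have hle : Cardinal.lift.{u + 1} μ ≤ #(C β) := by
    refine (Cardinal.lift_le.2 hcof).trans ?_
    rw [Ordinal.lift_cof, ← Ordinal.cof_Iio]
    have hcofin : IsCofinal {x : Iio β | x.1 ∈ C β} := by
      intro x
      obtain ⟨y, hy, hxy, hyβ⟩ := (h β hβle).1.2.2 x.1 x.2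
      exact ⟨⟨y, hyβ⟩, hy, hxy.le⟩
    refine (Order.cof_le hcofin).trans ?_
    exact Cardinal.mk_le_of_injective (f := fun x => (⟨x.1.1, x.2⟩ : C β)) fun x y hxy =>
      Subtype.ext (Subtype.ext (Subtype.mk.inj hxy))
  exact (hle.trans (Cardinal.mk_le_mk_of_subset hsubset)).not_gt hcard

end CubGames

namespace CubGames

variable {κ : Cardinal.{u}}

/-! ### The topology of `2^κ` -/

theorem isOpen_agree {δ : Ordinal.{u}} (hδ : δ < κ.ord) (a : Cantor κ) :
    IsOpen {η : Cantor κ | Agree δ a η} := by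
  apply TopologicalSpace.isOpen_generateFrom_of_mem
  refine ⟨δ, hδ, fun γ => a ⟨γ.1, lt_trans (mem_Iio.1 γ.2) hδ⟩, ?_⟩
  ext η
  exact forall₂_congr fun _ _ => eq_comm

theorem exists_agree_of_isOpen (hκ : κ.IsRegular) {U : Set (Cantor κ)} (hU : IsOpen U)
    {η : Cantor κ} (hη : η ∈ U) : ∃ α < κ.ord, ∀ ξ : Cantor κ, Agree α η ξ → ξ ∈ U := by
  induction hU with
  | basic V hV =>
    obtain ⟨α, hα, p, rfl⟩ := hV
    exact ⟨α, hα, fun ξ h γ hγ => (h γ hγ).symm.trans (hη γ hγ)⟩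
  | univ => exact ⟨0, hκ.ord_pos, fun _ _ => trivial⟩
  | inter V W _ _ ihV ihW =>
    obtain ⟨α, hα, h⟩ := ihV hη.1
    obtain ⟨β, hβ, h'⟩ := ihW hη.2
    exact ⟨max α β, max_lt hα hβ, fun ξ hξ =>
      ⟨h ξ (hξ.mono (le_max_left _ _)), h' ξ (hξ.mono (le_max_right _ _))⟩⟩
  | sUnion 𝒰 _ ih =>
    obtain ⟨V, hV, hη⟩ := hη
    obtain ⟨α, hα, h⟩ := ih V hV hη
    exact ⟨α, hα, fun ξ hξ => ⟨V, hV, h ξ hξ⟩⟩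

/-- The map `π` is continuous and open with respect to initial segments of length below `κ`. -/
structure IsCoding {V : Type w} {X : Type v} [TopologicalSpace X] (π : (Iio κ.ord → V) → X) :
    Prop where
  cont : ∀ U : Set X, IsOpen U → ∀ x, π x ∈ U → ∃ α < κ.ord, ∀ y, Agree α x y → π y ∈ U
  isOpen : ∀ P : Approx κ V, P.len < κ.ord →
    ∃ U : Set X, IsOpen U ∧ U.Nonempty ∧ ∀ z ∈ U, ∃ x, P.Ext x ∧ π x = z

/-- The second coordinate of a point. -/
def coordSnd (x : Iio κ.ord → Bool × Bool) : Cantor κ := fun γ => (x γ).2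

theorem isCoding_coord (hκ : κ.IsRegular) : IsCoding (κ := κ) coord where
  cont U hU x hx := by
    obtain ⟨α, hα, h⟩ := exists_agree_of_isOpen hκ hU hx
    exact ⟨α, hα, fun y hy => h _ (hy.comp Prod.fst)⟩
  isOpen P hP := by
    refine ⟨_, isOpen_agree hP (coord P.val), ⟨coord P.val, fun _ _ => rfl⟩, fun z hz => ?_⟩
    exact ⟨fun γ => (z γ, (P.val γ).2), fun γ hγ => Prod.ext (hz γ hγ) rfl, rfl⟩

theorem isCoding_prod (hκ : κ.IsRegular) :
    IsCoding (κ := κ) fun x : Iio κ.ord → Bool × Bool => (coord x, coordSnd x) where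
  cont U hU x hx := by
    obtain ⟨V, W, hV, hW, hxV, hxW, hVW⟩ := isOpen_prod_iff.1 hU _ _ hx
    obtain ⟨α, hα, h⟩ := exists_agree_of_isOpen hκ hV hxV
    obtain ⟨β, hβ, h'⟩ := exists_agree_of_isOpen hκ hW hxW
    exact ⟨max α β, max_lt hα hβ, fun y hy =>
      hVW ⟨h _ ((hy.mono (le_max_left _ _)).comp Prod.fst),
        h' _ ((hy.mono (le_max_right _ _)).comp Prod.snd)⟩⟩
  isOpen P hP := by
    refine ⟨_, (isOpen_agree hP (coord P.val)).prod (isOpen_agree hP (coordSnd P.val)),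
      ⟨(coord P.val, coordSnd P.val), fun _ _ => rfl, fun _ _ => rfl⟩, fun z hz => ?_⟩
    exact ⟨fun γ => (z.1 γ, z.2 γ), fun γ hγ => Prod.ext (hz.1 γ hγ) (hz.2 γ hγ), rfl⟩

/-- Applied to the exchange of the two factors, this permits either coordinate to be the common one.
-/
theorem IsCoding.homeomorph_comp {V : Type w} {X Y : Type v} [TopologicalSpace X]
    [TopologicalSpace Y] {π : (Iio κ.ord → V) → X} (hπ : IsCoding π) (e : X ≃ₜ Y) :
    IsCoding fun x => e (π x) where
  cont U hU x hx := hπ.cont (e ⁻¹' U) (hU.preimage e.continuous) x hx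
  isOpen P hP := by
    obtain ⟨U, hU, hU', h⟩ := hπ.isOpen P hP
    refine ⟨e '' U, e.isOpenMap U hU, hU'.image e, ?_⟩
    rintro _ ⟨z, hz, rfl⟩
    obtain ⟨x, hx, rfl⟩ := h z hz
    exact ⟨x, hx, rfl⟩

/-! ### Comeager sets and the Baire property -/

/-- `C ∩ N` contains the intersection with `N` of `κ` many open sets which are dense in the
open subsets of `N`. -/
def RelComeager (κ : Cardinal.{u}) {X : Type v} [TopologicalSpace X] (N C : Set X) : Prop :=
  ∃ U : Iio κ.ord → Set X,
    (∀ i, IsOpen (U i) ∧ ∀ V, IsOpen V → V.Nonempty → V ⊆ N → (V ∩ U i).Nonempty) ∧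
    ∀ x ∈ N, (∀ i, x ∈ U i) → x ∈ C

theorem ComeagerIn.relComeager {X : Type v} [TopologicalSpace X] {N C : Set X}
    (h : ComeagerIn κ N C) : RelComeager κ N C := by
  classical
  obtain ⟨o, ho, U, hU, hUC⟩ := h
  have key : ∀ i, ∃ W : Set X, IsOpen W ∧ Subtype.val ⁻¹' W = U i :=
    fun i => isOpen_induced_iff.1 (hU i).1
  choose W hW hWU using key
  -- Families shorter than `κ` are padded with the whole space.
  refine ⟨fun i => if h : i.1 < o then W ⟨i.1, h⟩ else univ, fun i => ?_, fun x hx hxW => ?_⟩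
  · by_cases h : i.1 < o
    · simp only [dif_pos h]
      refine ⟨hW _, fun V hV ⟨x, hx⟩ hVN => ?_⟩
      obtain ⟨y, hy, hy'⟩ := (hU ⟨i.1, h⟩).2.inter_open_nonempty _
        (hV.preimage continuous_subtype_val) ⟨⟨x, hVN hx⟩, hx⟩
      rw [← hWU] at hy'
      exact ⟨y.1, hy, hy'⟩
    · simp only [dif_neg h]
      exact ⟨isOpen_univ, fun V _ hV _ => by simpa using hV⟩
  · refine hUC (a := ⟨x, hx⟩) (mem_iInter.2 fun i => ?_)
    rw [← hWU]
    have := hxW ⟨i.1, lt_of_lt_of_le (mem_Iio.1 i.2) ho⟩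
    simp only [dif_pos (mem_Iio.1 i.2)] at this
    exact this

/-- Above `R`, an approximation covers a nonempty open subset of `N`, which meets `U i`; continuity
of `π` then secures membership in `U i` by an initial segment. -/
theorem RelComeager.comeagerAbove {V : Type w} {X : Type v} [TopologicalSpace X]
    {π : (Iio κ.ord → V) → X} (hπ : IsCoding π) {N C C' : Set X} (h : RelComeager κ N C)
    {R : Approx κ V} (hR : ∀ x, R.Ext x → π x ∈ N) (hC : C ∩ N ⊆ C') :
    Approx.ComeagerAbove R (π ⁻¹' C') := by
  obtain ⟨U, hU, hUC⟩ := h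
  refine ⟨fun i => π ⁻¹' U i, fun i P hRP hP => ?_, fun x hx hxU =>
    hC ⟨hUC _ (hR x hx) hxU, hR x hx⟩⟩
  obtain ⟨W, hW, hW', h⟩ := hπ.isOpen P hP
  obtain ⟨z, hz, hzU⟩ := (hU i).2 W hW hW' fun z hz => by
    obtain ⟨x, hx, rfl⟩ := h z hz
    exact hR x (hx.mono hRP)
  obtain ⟨x, hx, rfl⟩ := h z hz
  obtain ⟨α, hα, h'⟩ := hπ.cont _ (hU i).1 x hzU
  exact ⟨⟨max P.len α, x⟩, hx.le (le_max_left _ _), max_lt hP hα, fun y hy =>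
    h' y (Agree.mono hy (le_max_right _ _))⟩

/-- `D` contains an intersection of `κ` many dense open sets. -/
def Residual (κ : Cardinal.{u}) {X : Type v} [TopologicalSpace X] (D : Set X) : Prop :=
  ∃ U : Iio κ.ord → Set X, (∀ i, IsOpen (U i) ∧ Dense (U i)) ∧ ⋂ i, U i ⊆ D

variable {X : Type v} [TopologicalSpace X]

theorem Residual.relComeager {D : Set X} (h : Residual κ D) : RelComeager κ univ D := by
  obtain ⟨U, hU, hUD⟩ := h
  exact ⟨U, fun i => ⟨(hU i).1, fun V hV hV' _ => (hU i).2.inter_open_nonempty V hV hV'⟩,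
    fun x _ hx => hUD (mem_iInter.2 hx)⟩

theorem mk_Iio_ord (κ : Cardinal.{u}) : #(Iio κ.ord) = Cardinal.lift.{u + 1} κ := by
  rw [Cardinal.mk_Iio_ordinal, Cardinal.card_ord]

theorem residual_of_family {ι : Type (u + 1)} (hι : #ι ≤ Cardinal.lift.{u + 1} κ)
    {U : ι → Set X} (hU : ∀ i, IsOpen (U i) ∧ Dense (U i)) {D : Set X} (hD : ⋂ i, U i ⊆ D) :
    Residual κ D := by
  rcases isEmpty_or_nonempty ι with h | h
  · refine ⟨fun _ => univ, fun _ => ⟨isOpen_univ, dense_univ⟩, fun x _ => hD ?_⟩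
    simp
  · rw [← mk_Iio_ord, Cardinal.le_def] at hι
    obtain ⟨e⟩ := hι
    refine ⟨fun i => U (Function.invFun e i), fun i => hU _, fun x hx => hD ?_⟩
    refine mem_iInter.2 fun i => ?_
    have := mem_iInter.1 hx (e i)
    rwa [Function.leftInverse_invFun e.injective i] at this

theorem Residual.iInter (hκ : κ.IsRegular) {ι : Type (u + 1)}
    (hι : #ι ≤ Cardinal.lift.{u + 1} κ) {D : ι → Set X} (hD : ∀ i, Residual κ (D i)) :
    Residual κ (⋂ i, D i) := by
  choose U hU hUD using hD
  refine residual_of_family (ι := ι × Iio κ.ord) ?_ (U := fun p => U p.1 p.2)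
    (fun p => hU p.1 p.2) fun x hx => mem_iInter.2 fun i => hUD i (mem_iInter.2 fun j =>
      mem_iInter.1 hx (i, j))
  rw [Cardinal.mk_prod, Cardinal.lift_id, Cardinal.lift_id, mk_Iio_ord]
  refine (mul_le_mul_left hι _).trans (Cardinal.mul_eq_self ?_).le
  simpa using hκ.aleph0_le

theorem Residual.mono {D D' : Set X} (h : Residual κ D) (hD : D ⊆ D') : Residual κ D' := by
  obtain ⟨U, hU, hUD⟩ := h
  exact ⟨U, hU, hUD.trans hD⟩

theorem residual_of_isOpen_dense (hκ : κ.IsRegular) {U : Set X} (hU : IsOpen U) (hd : Dense U) :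
    Residual κ U :=
  ⟨fun _ => U, fun _ => ⟨hU, hd⟩, iInter_subset (fun _ : Iio κ.ord => U) ⟨0, hκ.ord_pos⟩⟩

theorem Residual.inter (hκ : κ.IsRegular) {D D' : Set X} (h : Residual κ D)
    (h' : Residual κ D') : Residual κ (D ∩ D') := by
  have : Residual κ (⋂ i : ULift.{u + 1} Bool, if i.down then D else D') := by
    refine Residual.iInter hκ ?_ fun i => ?_
    · refine le_trans (Cardinal.lt_aleph0_of_finite _).le ?_
      simpa using hκ.aleph0_le
    · split_ifs
      exacts [h, h']
  refine this.mono fun x hx => ?_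
  have hx := mem_iInter.1 hx
  exact ⟨by simpa using hx ⟨true⟩, by simpa using hx ⟨false⟩⟩

/-- `A` is equal to an open set on a comeager set. -/
def HasBaireProperty (κ : Cardinal.{u}) (A : Set X) : Prop :=
  ∃ U D : Set X, IsOpen U ∧ Residual κ D ∧ ∀ x ∈ D, (x ∈ A ↔ x ∈ U)

/-- Off the nowhere dense boundary of `U`, the complement of `U` is its exterior. -/
theorem HasBaireProperty.compl (hκ : κ.IsRegular) {A : Set X} (h : HasBaireProperty κ A) :
    HasBaireProperty κ Aᶜ := by
  obtain ⟨U, D, hU, hD, hA⟩ := h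
  have hdense : Dense (U ∪ (closure U)ᶜ) := by
    rw [dense_iff_closure_eq, closure_union, eq_univ_iff_forall]
    intro x
    by_cases hx : x ∈ closure U
    · exact Or.inl hx
    · exact Or.inr (subset_closure hx)
  refine ⟨(closure U)ᶜ, D ∩ (U ∪ (closure U)ᶜ), isClosed_closure.isOpen_compl,
    hD.inter hκ (residual_of_isOpen_dense hκ (hU.union isClosed_closure.isOpen_compl) hdense),
    fun x hx => ?_⟩
  rw [mem_compl_iff, hA x hx.1]
  constructor
  · intro h
    exact hx.2.resolve_left h
  · exact fun h h' => h (subset_closure h')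

theorem HasBaireProperty.iUnion (hκ : κ.IsRegular) {ι : Type (u + 1)}
    (hι : #ι ≤ Cardinal.lift.{u + 1} κ) {A : ι → Set X} (h : ∀ i, HasBaireProperty κ (A i)) :
    HasBaireProperty κ (⋃ i, A i) := by
  choose U D hU hD hA using h
  refine ⟨⋃ i, U i, ⋂ i, D i, isOpen_iUnion hU, Residual.iInter hκ hι hD, fun x hx => ?_⟩
  simp only [mem_iUnion]
  exact exists_congr fun i => hA i x (mem_iInter.1 hx i)

theorem IsBorel.hasBaireProperty (hκ : κ.IsRegular) {A : Set X} (hA : IsBorel κ A) :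
    HasBaireProperty κ A := by
  have hcard : ∀ {o : Ordinal.{u}}, o ≤ κ.ord → #(Iio o) ≤ Cardinal.lift.{u + 1} κ := by
    intro o ho
    rw [← mk_Iio_ord]
    exact Cardinal.mk_le_mk_of_subset (Iio_subset_Iio ho)
  induction hA with
  | @of_isOpen U hU =>
    exact ⟨U, univ, hU, residual_of_isOpen_dense hκ isOpen_univ dense_univ, fun _ _ => Iff.rfl⟩
  | compl _ ih => exact ih.compl hκ
  | iUnion ho A _ ih => exact HasBaireProperty.iUnion hκ (hcard ho) ih
  | iInter ho A _ ih =>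
    have := (HasBaireProperty.iUnion hκ (hcard ho) fun i => (ih i).compl hκ).compl hκ
    simpa only [compl_iUnion, compl_compl] using this

/-- Here `κ^{<κ} = κ` enters: with at most `κ` basic open sets, one comeager set serves all of their
preimages. -/
theorem mk_sigma_cyl_le (hκ : κ.IsRegular) (hκκ : κ ^< κ = κ) :
    #(Σ α : Iio κ.ord, (Iio α.1 → Bool)) ≤ Cardinal.lift.{u + 1} κ := by
  have h : ∀ α : Iio κ.ord, #(Iio α.1 → Bool) ≤ Cardinal.lift.{u + 1} κ := by
    intro α
    rw [Cardinal.mk_arrow, Cardinal.mk_bool, Cardinal.mk_Iio_ordinal, Cardinal.lift_two,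
      Cardinal.lift_id'.{0, u + 1}, ← Cardinal.lift_two.{u + 1, u}, ← Cardinal.lift_power, Cardinal.lift_le]
    calc (2 : Cardinal.{u}) ^ α.1.card ≤ κ ^ α.1.card :=
          Cardinal.power_le_power_right ((Cardinal.natCast_lt_aleph0 (n := 2)).le.trans hκ.aleph0_le)
      _ ≤ κ ^< κ := Cardinal.le_powerlt _ (Cardinal.lt_ord.1 α.2)
      _ = κ := hκκ
  rw [Cardinal.mk_sigma]
  refine (Cardinal.sum_le_sum _ _ h).trans ?_
  rw [Cardinal.sum_const, Cardinal.lift_id, Cardinal.lift_id, mk_Iio_ord]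
  refine (Cardinal.mul_eq_self ?_).le
  simpa using hκ.aleph0_le

/-- A `κ`-Borel function into `2^κ` is continuous on a comeager set. -/
theorem BorelFun.exists_continuousOn (hκ : κ.IsRegular) (hκκ : κ ^< κ = κ) {f : X → Cantor κ}
    (hf : BorelFun κ f) : ∃ D, Residual κ D ∧ ContinuousOn f D := by
  have key : ∀ p : Σ α : Iio κ.ord, (Iio α.1 → Bool), HasBaireProperty κ (f ⁻¹' cyl κ p.2) :=
    fun p => (hf _ (TopologicalSpace.isOpen_generateFrom_of_mem
      ⟨p.1.1, p.1.2, p.2, rfl⟩)).hasBaireProperty hκ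
  choose U D hU hD hUD using key
  refine ⟨⋂ p, D p, Residual.iInter hκ (mk_sigma_cyl_le hκ hκκ) hD, ?_⟩
  rw [continuousOn_iff_continuous_domRestrict]
  refine continuous_generateFrom_iff.2 ?_
  rintro _ ⟨α, hα, p, rfl⟩
  have : (⋂ p, D p).domRestrict f ⁻¹' cyl κ p = Subtype.val ⁻¹' U ⟨⟨α, hα⟩, p⟩ := by
    ext x
    exact hUD ⟨⟨α, hα⟩, p⟩ x.1 (mem_iInter.1 x.2 _)
  rw [this]
  exact (hU _).preimage continuous_subtype_val

theorem BorelFun.comp_continuous {Y Z : Type*} [TopologicalSpace Y] [TopologicalSpace Z]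
    {f : X → Y} (hf : BorelFun κ f) {g : Y → Z} (hg : Continuous g) :
    BorelFun κ fun x => g (f x) :=
  fun _ hU => hf _ (hU.preimage hg)

theorem BorelFun.exists_continuousOn_prod (hκ : κ.IsRegular) (hκκ : κ ^< κ = κ)
    {f : X → Cantor κ × Cantor κ} (hf : BorelFun κ f) :
    ∃ D, Residual κ D ∧ ContinuousOn f D := by
  obtain ⟨D, hD, h⟩ := (hf.comp_continuous continuous_fst).exists_continuousOn hκ hκκ
  obtain ⟨D', hD', h'⟩ := (hf.comp_continuous continuous_snd).exists_continuousOn hκ hκκ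
  exact ⟨D ∩ D', hD.inter hκ hD', (h.mono inter_subset_left).prodMk (h'.mono inter_subset_right)⟩

/-! ### Reductions give reductions of pairs -/

variable {Y : Type w} [TopologicalSpace Y]

/-- The maps `q c` read off the coordinates of the target, so single relations (with `q` constant)
and products are treated alike. -/
theorem exists_pairReduction {π : (Iio κ.ord → Bool × Bool) → X}
    (hπ : IsCoding π) {E : X → X → Prop} {E' : Y → Y → Prop} {S : Set Ordinal.{u}}
    {T : Bool → Set Ordinal.{u}} {q : Bool → Y → Cantor κ} (hq : ∀ c, Continuous (q c))
    (hE : ∀ x y, (∀ γ, (x γ).2 = (y γ).2) → (E (π x) (π y) ↔ ES κ S (coord x) (coord y)))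
    (hE' : ∀ y y', E' y y' ↔ ∀ c, ES κ (T c) (q c y) (q c y'))
    {N C C' : Set X} {R : Approx κ (Bool × Bool)} (hR : R.len < κ.ord)
    (hRN : ∀ x, R.Ext x → π x ∈ N) (hC : RelComeager κ N C) (hC' : C ∩ N ⊆ C')
    (h : ContinuouslyReducibleOn C' E E') : Nonempty (PairReduction κ S T) := by
  classical
  obtain ⟨f, hf, hred⟩ := h
  -- The value `coord x` off the domain is arbitrary.
  let g : Bool → (Iio κ.ord → Bool × Bool) → Cantor κ := fun c x =>
    if h : π x ∈ C' then q c (f ⟨π x, h⟩) else coord x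
  have hg : ∀ (c x) (h : π x ∈ C'), g c x = q c (f ⟨π x, h⟩) := fun c x h => dif_pos h
  refine ⟨⟨R, π ⁻¹' C', g, hR, hC.comeagerAbove hπ hRN hC', ?_, ?_⟩⟩
  · intro c x hx δ hδ
    have ho : IsOpen {z : C' | Agree δ (g c x) (q c (f z))} :=
      (isOpen_agree hδ (g c x)).preimage ((hq c).comp hf)
    obtain ⟨W, hW, hWe⟩ := isOpen_induced_iff.1 ho
    have hxW : (⟨π x, hx⟩ : C') ∈ Subtype.val ⁻¹' W := by
      rw [hWe, mem_ofPred_eq, hg c x hx]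
      exact fun _ _ => rfl
    obtain ⟨α, hα, hαW⟩ := hπ.cont W hW x hxW
    refine ⟨α, hα, fun y hy hxy => ?_⟩
    have : (⟨π y, hy⟩ : C') ∈ Subtype.val ⁻¹' W := hαW y hxy
    rw [hWe, mem_ofPred_eq, ← hg c y hy] at this
    exact this
  · intro x hx y hy hxy
    rw [← hE x y hxy]
    refine (hred ⟨π x, hx⟩ ⟨π y, hy⟩).trans ((hE' _ _).trans (forall_congr' fun c => ?_))
    rw [hg c x hx, hg c y hy]

theorem BorelReducible.exists_continuouslyReducibleOn {E : X → X → Prop} {E' : Y → Y → Prop}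
    (hY : ∀ f : X → Y, BorelFun κ f → ∃ D, Residual κ D ∧ ContinuousOn f D)
    (h : BorelReducible κ E E') : ∃ D, Residual κ D ∧ ContinuouslyReducibleOn D E E' := by
  obtain ⟨f, hf, hred⟩ := h
  obtain ⟨D, hD, hc⟩ := hY f hf
  exact ⟨D, hD, D.domRestrict f, continuousOn_iff_continuous_domRestrict.1 hc,
    fun η ξ => hred η.1 ξ.1⟩

end CubGames

namespace CubGames

variable {κ : Cardinal.{u}}

/-! ### Non-reducibility -/

namespace PairReduction

variable {S : Set Ordinal.{u}} {T : Bool → Set Ordinal.{u}}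

/-- A play along the ladder of some `α ∈ T c \ S` has its earlier limits among the limit points of
the ladder, hence outside `S`, and ends at `α`, which the strategy prevents. -/
theorem false_of_ladderSystem (ρ : PairReduction κ S T) (hκ : κ.IsRegular) (hκ' : ℵ₀ < κ)
    (hS : (0 : Ordinal.{u}) ∉ S) {μ : Cardinal.{u}} (hμ : μ ∈ reg κ)
    {C : Ordinal.{u} → Set Ordinal.{u}} (hC : IsLadderSystem κ μ (cofEq κ μ) C)
    (hCS : ∀ α ∈ cofEq κ μ, ∀ β ∈ limBelow α (C α), β ∉ S)
    (hT : ∀ c, ∀ G : Ordinal.{u} → Ordinal.{u}, (∀ x < κ.ord, G x < κ.ord) →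
      ((T c \ S) ∩ (closurePoints κ G ∩ cofEq κ μ)).Nonempty) : False := by
  obtain ⟨c, σ, hσ⟩ := ρ.exists_strategy hκ hS
  obtain ⟨G, hG, hplay⟩ := hC.exists_play hκ hκ' hμ σ
  obtain ⟨α, hαT, hαG, hα⟩ := hT c G hG
  obtain ⟨a, ha, rfl, hlim⟩ := hplay α hα hαG
  exact (hσ μ hμ a ha).2 (fun i hi => hCS _ hα _ (hlim i hi)) hαT

theorem false_of_lamStationary (ρ : PairReduction κ S T) (hκ : κ.IsRegular) (hκ' : ℵ₀ < κ)
    (hS : (0 : Ordinal.{u}) ∉ S) (hT : ∀ c, LamStationary κ ℵ₀ (T c \ S)) : False := by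
  obtain ⟨C, hC⟩ := exists_isLadderSystem_aleph0 κ
  refine ρ.false_of_ladderSystem hκ hκ' hS (aleph0_mem_reg hκ') hC (fun α hα β hβ _ => ?_)
    fun c G hG => hT c _ (isLamCub_closurePoints hκ hκ' hG)
  have h1 := hC.cof_lt α hα β hβ
  -- Finite cofinality would make `β` zero or a successor, which a limit point is not; so these
  -- ladders have no limit points.
  rw [Ordinal.cof_lt_aleph0_iff, ← not_lt, Ordinal.one_lt_cof_iff] at h1
  refine h1 ⟨?_, ?_⟩
  · rw [isMin_iff_eq_bot]
    exact hβ.2.1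
  · intro γ hγ
    obtain ⟨δ, -, h1, h2⟩ := hβ.2.2 γ hγ.lt
    exact hγ.2 h1 h2

/-- Limits at stages `i < λ` have cofinality at most `|i| < λ` and so avoid `S`. The strategy
therefore wins the game for the complement of `T c \ S`, which must contain a `λ`-cub set. -/
theorem false_of_gcCharacterization (ρ : PairReduction κ S T) (hκ : κ.IsRegular) (hκ' : ℵ₀ < κ)
    {lam : Cardinal.{u}} (hlam : lam ∈ reg κ) (hGC : GCCharacterization κ lam)
    (hS : S ⊆ cofGe κ lam) (hT : ∀ c, Stationary κ ((T c \ S) ∩ cofEq κ lam)) : False := by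
  have hScof : ∀ δ ∈ S, lam ≤ δ.cof := by
    intro δ hδ
    obtain ⟨ν, hν, hδν⟩ := mem_iUnion₂.1 (hS hδ)
    exact hδν.2 ▸ hν.2
  have hS0 : (0 : Ordinal.{u}) ∉ S := fun h => by
    have := hScof 0 h
    rw [Ordinal.cof_zero] at this
    exact this.not_gt hlam.1.pos
  obtain ⟨c, σ, hσ⟩ := ρ.exists_strategy hκ hS0
  obtain ⟨C, hCA, hC⟩ := (hGC (Iio κ.ord \ (T c \ S)) sdiff_subset).1 ⟨σ, fun a ha => by
    obtain ⟨h1, h2⟩ := hσ lam hlam a ha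
    refine ⟨h1, iSup_Iio_lt_ord hκ (Cardinal.ord_lt_ord.2 hlam.2) fun i => (a i).2,
      h2 fun i hi hmem => ?_⟩
    have hmono : StrictMono fun j : Iio i.1 =>
        (a ⟨j.1, lt_trans (mem_Iio.1 j.2) (mem_Iio.1 i.2)⟩ : Ordinal.{u}) :=
      fun j k hjk => (ha ⟨k.1, _⟩ ⟨j.1, _⟩ hjk).1
    have h3 := hScof _ hmem
    rw [Ordinal.cof_iSup_Iio hmono hi.isSuccPrelimit] at h3
    exact (h3.trans (Ordinal.cof_le_card _)).not_gt (Cardinal.lt_ord.1 i.2)⟩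
  obtain ⟨α, hα, hαC⟩ := (hT c).inter_isLamCub_nonempty hκ hκ' hlam.1 hC
  exact (hCA hαC).2 hα

end PairReduction

theorem not_reducible {X : Type v} [TopologicalSpace X] {Y : Type w} [TopologicalSpace Y]
    (hκ : κ.IsRegular) {π : (Iio κ.ord → Bool × Bool) → X} (hπ : IsCoding π)
    {E : X → X → Prop} {E' : Y → Y → Prop} {S : Set Ordinal.{u}} {T : Bool → Set Ordinal.{u}}
    (hno : PairReduction κ S T → False) (q : Bool → Y → Cantor κ) (hq : ∀ c, Continuous (q c))
    (hE : ∀ x y, (∀ γ, (x γ).2 = (y γ).2) → (E (π x) (π y) ↔ ES κ S (coord x) (coord y)))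
    (hE' : ∀ y y', E' y y' ↔ ∀ c, ES κ (T c) (q c y) (q c y'))
    (hY : ∀ f : X → Y, BorelFun κ f → ∃ D, Residual κ D ∧ ContinuousOn f D) :
    ¬ BorelReducible κ E E' ∧ ∀ (N C C' : Set X) (R : Approx κ (Bool × Bool)), R.len < κ.ord →
      (∀ x, R.Ext x → π x ∈ N) → ComeagerIn κ N C → C ∩ N ⊆ C' →
      ¬ ContinuouslyReducibleOn C' E E' := by
  refine ⟨fun h => ?_, fun N C C' R hR hRN hC hC' h => ?_⟩
  · obtain ⟨D, hD, h⟩ := h.exists_continuouslyReducibleOn hY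
    obtain ⟨ρ⟩ := exists_pairReduction hπ hq hE hE' (R := ⟨0, fun _ => (false, false)⟩) hκ.ord_pos
      (fun _ _ => mem_univ _) hD.relComeager inter_subset_left h
    exact hno ρ
  · obtain ⟨ρ⟩ := exists_pairReduction hπ hq hE hE' hR hRN hC.relComeager hC' h
    exact hno ρ

theorem ES.refl (hκ : κ.IsRegular) {S : Set Ordinal.{u}} (hS : (0 : Ordinal.{u}) ∉ S)
    (η : Cantor κ) : ES κ S η η :=
  ⟨fun _ hδ _ => ⟨0, pos_iff_ne_zero.2 fun h => hS (h ▸ hδ), false, fun γ _ _ =>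
    Bool.xor_self (η γ)⟩, 0, hκ.ord_pos, fun _ _ => rfl⟩

open Classical in
/-- The approximation given by a pair of functions on initial segments of `κ`. -/
noncomputable def pairRoot (κ : Cardinal.{u}) {α₁ α₂ : Ordinal.{u}} (p₁ : Iio α₁ → Bool)
    (p₂ : Iio α₂ → Bool) : Approx κ (Bool × Bool) :=
  ⟨max α₁ α₂, fun γ => (if h : γ.1 < α₁ then p₁ ⟨γ.1, h⟩ else false,
    if h : γ.1 < α₂ then p₂ ⟨γ.1, h⟩ else false)⟩

theorem coord_mem_cyl {α₁ α₂ : Ordinal.{u}} {p₁ : Iio α₁ → Bool} {p₂ : Iio α₂ → Bool}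
    {x : Iio κ.ord → Bool × Bool} (hx : (pairRoot κ p₁ p₂).Ext x) : coord x ∈ cyl κ p₁ := by
  intro γ hγ
  have h := congrArg Prod.fst (hx γ (lt_of_lt_of_le hγ (le_max_left _ _)))
  simp only [pairRoot, dif_pos hγ] at h
  exact h.symm

theorem coordSnd_mem_cyl {α₁ α₂ : Ordinal.{u}} {p₁ : Iio α₁ → Bool} {p₂ : Iio α₂ → Bool}
    {x : Iio κ.ord → Bool × Bool} (hx : (pairRoot κ p₁ p₂).Ext x) : coordSnd x ∈ cyl κ p₂ := by
  intro γ hγ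
  have h := congrArg Prod.snd (hx γ (lt_of_lt_of_le hγ (le_max_right _ _)))
  simp only [pairRoot, dif_pos hγ] at h
  exact h.symm

/-! ### Single and product relations as sources and targets -/

section Shapes

variable {S S₁ A₁ S₂ A₂ : Set Ordinal.{u}}

theorem not_reducible_single (hκ : κ.IsRegular) (hκκ : κ ^< κ = κ)
    (hno : PairReduction κ S₁ (fun _ => S₂) → False) :
    ¬ BorelReducible κ (ES κ S₁) (ES κ S₂) ∧
    ∀ α < κ.ord, ∀ (p : Iio α → Bool) (C : Set (Cantor κ)),
      C ⊆ cyl κ p → ComeagerIn κ (cyl κ p) C →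
      ¬ ContinuouslyReducibleOn C (ES κ S₁) (ES κ S₂) := by
  have := not_reducible hκ (isCoding_coord hκ) hno (fun _ => id) (fun _ => continuous_id)
    (fun _ _ _ => Iff.rfl) (fun y y' => ⟨fun h _ => h, fun h => h true⟩)
    (fun f hf => hf.exists_continuousOn hκ hκκ)
  refine ⟨this.1, fun α hα p C hCp hC => this.2 (cyl κ p) C C
    -- A single source has no second coordinate; the auxiliary one is ignored by `coord`, and its
    -- root may be anything.
    (pairRoot κ p (α₂ := 0) fun _ => false) (max_lt hα hκ.ord_pos)
    (fun x hx => coord_mem_cyl hx) hC inter_subset_left⟩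

theorem prodRel_iff_forall (y y' : Cantor κ × Cantor κ) :
    prodRel (ES κ S₂) (ES κ A₂) y y' ↔ ∀ c : Bool,
      ES κ (bif c then A₂ else S₂) (bif c then y.2 else y.1) (bif c then y'.2 else y'.1) :=
  (Bool.forall_bool (p := fun c => ES κ (bif c then A₂ else S₂) (bif c then y.2 else y.1)
    (bif c then y'.2 else y'.1))).symm

theorem not_reducible_single_prod (hκ : κ.IsRegular) (hκκ : κ ^< κ = κ)
    (hno : PairReduction κ S₁ (fun c => bif c then A₂ else S₂) → False) :
    ¬ BorelReducible κ (ES κ S₁) (prodRel (ES κ S₂) (ES κ A₂)) ∧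
    ∀ α < κ.ord, ∀ (p : Iio α → Bool) (C : Set (Cantor κ)),
      C ⊆ cyl κ p → ComeagerIn κ (cyl κ p) C →
      ¬ ContinuouslyReducibleOn C (ES κ S₁) (prodRel (ES κ S₂) (ES κ A₂)) := by
  have := not_reducible hκ (isCoding_coord hκ) hno (fun c y => bif c then y.2 else y.1)
    (by rintro (_ | _); exacts [continuous_fst, continuous_snd])
    (fun _ _ _ => Iff.rfl) prodRel_iff_forall
    (fun f hf => hf.exists_continuousOn_prod hκ hκκ)
  refine ⟨this.1, fun α hα p C hCp hC => this.2 (cyl κ p) C C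
    (pairRoot κ p (α₂ := 0) fun _ => false) (max_lt hα hκ.ord_pos)
    (fun x hx => coord_mem_cyl hx) hC inter_subset_left⟩

theorem prodRel_iff_fst (hκ : κ.IsRegular) (hA : (0 : Ordinal.{u}) ∉ A₁)
    (x y : Iio κ.ord → Bool × Bool) (h : ∀ γ, (x γ).2 = (y γ).2) :
    prodRel (ES κ S₁) (ES κ A₁) (coord x, coordSnd x) (coord y, coordSnd y) ↔
      ES κ S₁ (coord x) (coord y) := by
  have : coordSnd x = coordSnd y := funext h
  exact ⟨fun h => h.1, fun h => ⟨h, this ▸ ES.refl hκ hA _⟩⟩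

theorem prodRel_iff_snd (hκ : κ.IsRegular) (hS : (0 : Ordinal.{u}) ∉ S₁)
    (x y : Iio κ.ord → Bool × Bool) (h : ∀ γ, (x γ).2 = (y γ).2) :
    prodRel (ES κ S₁) (ES κ A₁) (coordSnd x, coord x) (coordSnd y, coord y) ↔
      ES κ A₁ (coord x) (coord y) := by
  have : coordSnd x = coordSnd y := funext h
  exact ⟨fun h => h.2, fun h => ⟨this ▸ ES.refl hκ hS _, h⟩⟩

/-- Non-reducibility of a product follows if the reduction is impossible on pairs which differ
in one fixed coordinate only. -/
theorem not_reducible_prod (hκ : κ.IsRegular) {Y : Type w} [TopologicalSpace Y]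
    {E' : Y → Y → Prop} {T : Bool → Set Ordinal.{u}}
    (hno : (0 : Ordinal.{u}) ∉ A₁ ∧ (PairReduction κ S₁ T → False) ∨
      (0 : Ordinal.{u}) ∉ S₁ ∧ (PairReduction κ A₁ T → False))
    (q : Bool → Y → Cantor κ) (hq : ∀ c, Continuous (q c))
    (hE' : ∀ y y', E' y y' ↔ ∀ c, ES κ (T c) (q c y) (q c y'))
    (hY : ∀ f : Cantor κ × Cantor κ → Y, BorelFun κ f → ∃ D, Residual κ D ∧ ContinuousOn f D) :
    ¬ BorelReducible κ (prodRel (ES κ S₁) (ES κ A₁)) E' ∧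
    ∀ α₁ < κ.ord, ∀ α₂ < κ.ord, ∀ (p₁ : Iio α₁ → Bool) (p₂ : Iio α₂ → Bool)
      (C C' : Set (Cantor κ × Cantor κ)), ComeagerIn κ (cyl κ p₁ ×ˢ cyl κ p₂) C →
      C ∩ cyl κ p₁ ×ˢ cyl κ p₂ ⊆ C' →
      ¬ ContinuouslyReducibleOn C' (prodRel (ES κ S₁) (ES κ A₁)) E' := by
  rcases hno with ⟨h0, hno⟩ | ⟨h0, hno⟩
  · have := not_reducible hκ (isCoding_prod hκ) hno q hq (prodRel_iff_fst hκ h0) hE' hY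
    exact ⟨this.1, fun α₁ h₁ α₂ h₂ p₁ p₂ C C' hC hC' => this.2 (cyl κ p₁ ×ˢ cyl κ p₂) C C' (pairRoot κ p₁ p₂)
      (max_lt h₁ h₂) (fun x hx => ⟨coord_mem_cyl hx, coordSnd_mem_cyl hx⟩) hC hC'⟩
  · have := not_reducible hκ ((isCoding_prod hκ).homeomorph_comp (Homeomorph.prodComm _ _)) hno
      q hq (prodRel_iff_snd hκ h0) hE' hY
    exact ⟨this.1, fun α₁ h₁ α₂ h₂ p₁ p₂ C C' hC hC' => this.2 (cyl κ p₁ ×ˢ cyl κ p₂) C C' (pairRoot κ p₂ p₁)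
      (max_lt h₂ h₁) (fun x hx => ⟨coordSnd_mem_cyl hx, coord_mem_cyl hx⟩) hC hC'⟩

theorem zero_notMem_of_subset_cofEq {μ : Cardinal.{u}} (hμ : μ.IsRegular) (h : S ⊆ cofEq κ μ) :
    (0 : Ordinal.{u}) ∉ S := fun h0 => by
  have := (h h0).2
  rw [Ordinal.cof_zero] at this
  exact hμ.ne_zero this.symm

theorem zero_notMem_of_subset_limits (h : S ⊆ limits κ) : (0 : Ordinal.{u}) ∉ S :=
  fun h0 => (h h0).2.ne_bot rfl

theorem LamStationary.mono {lam : Cardinal.{u}} {X X' : Set Ordinal.{u}}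
    (h : LamStationary κ lam X) (hX : X ⊆ X') : LamStationary κ lam X' :=
  fun C hC => (h C hC).mono (inter_subset_inter_left _ hX)

theorem Stationary.lamStationary (hκ : κ.IsRegular) (hκ' : ℵ₀ < κ) {lam : Cardinal.{u}}
    (hlam : lam.IsRegular) {X : Set Ordinal.{u}} (h : Stationary κ X) (hX : X ⊆ cofEq κ lam) :
    LamStationary κ lam X := by
  rw [← inter_eq_left.2 hX] at h
  exact fun C hC => h.inter_isLamCub_nonempty hκ hκ' hlam hC

end Shapes

/-- Limit points of `C α` avoid `S₁` because their cofinality is below `μ`, and avoid `B` by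
non-reflection. -/
theorem PairReduction.false_of_isSquareSeq (hκ : κ.IsRegular) (hκ' : ℵ₀ < κ) {μ : Cardinal.{u}}
    (hμ : μ ∈ reg κ \ {ℵ₀}) {C : Ordinal.{u} → Set Ordinal.{u}} (hC : IsSquareSeq κ μ C)
    {S Bnr S₁ S₂ B : Set Ordinal.{u}} (hS : S ⊆ cofEq κ ℵ₀)
    (hBnr : IsNonreflectingPart κ μ C S Bnr) (hS₁ : S₁ ⊆ cofEq κ μ) (hB : B ⊆ Bnr)
    (hst : Stationary κ (((S₂ ∪ B) \ (S₁ ∪ B)) ∩ cofEq κ μ))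
    (ρ : PairReduction κ (S₁ ∪ B) fun _ => S₂ ∪ B) : False := by
  have hμ' : ℵ₀ < μ := lt_of_le_of_ne hμ.1.1.aleph0_le (Ne.symm hμ.2)
  have hL := hC.isLadderSystem hμ.1 hμ'
  refine ρ.false_of_ladderSystem hκ hκ' ?_ hμ.1 hL (fun α hα β hβ hmem => ?_) fun _ G hG => ?_
  · rintro (h | h)
    · exact zero_notMem_of_subset_cofEq hμ.1.1 hS₁ h
    · exact zero_notMem_of_subset_cofEq isRegular_aleph0 ((hB.trans hBnr.1).trans hS) h
  · rcases hmem with h | h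
    · exact (hL.cof_lt α hα β hβ).ne (hS₁ h).2
    · refine (hBnr.2 α ⟨mem_iUnion₂.2 ⟨μ, ⟨hμ.1, le_rfl⟩, hα⟩,
        mem_iUnion₂.2 ⟨μ, ⟨hμ.1, ?_⟩, hα⟩⟩ hβ).2 (hB h)
      rw [← Cardinal.succ_aleph0]
      exact Order.succ_le_of_lt hμ'
  · obtain ⟨α, ⟨h1, h2⟩, h3⟩ := hst _ (isCub_closurePoints hκ hκ' hG)
    exact ⟨α, h1, h3, h2⟩

end CubGames

/-! ### Assembly of the five parts -/

theorem theorem27 (κ lam : Cardinal.{u}) (hκ : κ.IsRegular) (hκκ : κ ^< κ = κ)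
    (hlam : lam ∈ CubGames.reg κ) (hGC : CubGames.GCCharacterization κ lam) :
    -- Part 1
    (∀ S₁ S₂ : Set Ordinal.{u}, S₁ ⊆ CubGames.cofGe κ lam → S₂ ⊆ CubGames.cofGe κ lam →
      CubGames.Stationary κ ((S₂ \ S₁) ∩ CubGames.cofEq κ lam) →
        ¬ CubGames.BorelReducible κ (CubGames.ES κ S₁) (CubGames.ES κ S₂) ∧
        ∀ α < κ.ord, ∀ (p : Set.Iio α → Bool) (C : Set (CubGames.Cantor κ)),
          C ⊆ CubGames.cyl κ p → CubGames.ComeagerIn κ (CubGames.cyl κ p) C →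
          ¬ CubGames.ContinuouslyReducibleOn C (CubGames.ES κ S₁) (CubGames.ES κ S₂)) ∧
    -- Part 2
    (∀ ν μ : Cardinal.{u}, κ = Order.succ ν → ℵ₁ < κ → μ ∈ CubGames.reg κ \ {ℵ₀} →
      ∀ Csq : Ordinal.{u} → Set Ordinal.{u}, CubGames.IsSquareSeq κ μ Csq →
      ∀ S Bnr : Set Ordinal.{u}, S ⊆ CubGames.cofEq κ ℵ₀ → CubGames.Stationary κ S →
      CubGames.IsNonreflectingPart κ μ Csq S Bnr →
      ∀ S₁ S₂ B : Set Ordinal.{u}, S₁ ⊆ CubGames.cofEq κ μ → S₂ ⊆ CubGames.cofEq κ μ →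
      B ⊆ Bnr →
      CubGames.Stationary κ (((S₂ ∪ B) \ (S₁ ∪ B)) ∩ CubGames.cofEq κ μ) →
        ¬ CubGames.BorelReducible κ (CubGames.ES κ (S₁ ∪ B)) (CubGames.ES κ (S₂ ∪ B)) ∧
        ∀ α < κ.ord, ∀ (p : Set.Iio α → Bool) (C : Set (CubGames.Cantor κ)),
          C ⊆ CubGames.cyl κ p → CubGames.ComeagerIn κ (CubGames.cyl κ p) C →
          ¬ CubGames.ContinuouslyReducibleOn C
            (CubGames.ES κ (S₁ ∪ B)) (CubGames.ES κ (S₂ ∪ B))) ∧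
    -- Part 3
    (∀ S₁ S₂ A₁ A₂ : Set Ordinal.{u},
      S₁ ⊆ CubGames.cofEq κ ℵ₀ → S₂ ⊆ CubGames.cofEq κ ℵ₀ →
      A₁ ⊆ CubGames.cofEq κ ℵ₀ → A₂ ⊆ CubGames.cofEq κ ℵ₀ →
      (CubGames.Stationary κ (S₂ \ S₁) ∧ CubGames.Stationary κ (A₂ \ S₁) ∨
        CubGames.Stationary κ (S₂ \ A₁) ∧ CubGames.Stationary κ (A₂ \ A₁)) →
        ¬ CubGames.BorelReducible κ
          (CubGames.prodRel (CubGames.ES κ S₁) (CubGames.ES κ A₁))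
          (CubGames.prodRel (CubGames.ES κ S₂) (CubGames.ES κ A₂)) ∧
        ∀ α < κ.ord, ∀ (r₁ r₂ : Set.Iio α → Bool)
          (C : Set (CubGames.Cantor κ × CubGames.Cantor κ)),
          CubGames.ComeagerIn κ (CubGames.cyl κ r₁ ×ˢ CubGames.cyl κ r₂) C →
          ¬ CubGames.ContinuouslyReducibleOn (C ∩ CubGames.cyl κ r₁ ×ˢ CubGames.cyl κ r₂)
            (CubGames.prodRel (CubGames.ES κ S₁) (CubGames.ES κ A₁))
            (CubGames.prodRel (CubGames.ES κ S₂) (CubGames.ES κ A₂))) ∧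
    -- Part 4
    (∀ S₁ S₂ A₂ : Set Ordinal.{u},
      S₁ ⊆ CubGames.limits κ → S₂ ⊆ CubGames.limits κ → A₂ ⊆ CubGames.limits κ →
      CubGames.LamStationary κ ℵ₀ (A₂ \ S₁) → CubGames.LamStationary κ ℵ₀ (S₂ \ S₁) →
        ¬ CubGames.BorelReducible κ (CubGames.ES κ S₁)
          (CubGames.prodRel (CubGames.ES κ S₂) (CubGames.ES κ A₂)) ∧
        ∀ α < κ.ord, ∀ (p : Set.Iio α → Bool) (C : Set (CubGames.Cantor κ)),
          C ⊆ CubGames.cyl κ p → CubGames.ComeagerIn κ (CubGames.cyl κ p) C →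
          ¬ CubGames.ContinuouslyReducibleOn C (CubGames.ES κ S₁)
            (CubGames.prodRel (CubGames.ES κ S₂) (CubGames.ES κ A₂))) ∧
    -- Part 5
    (∀ S₁ A₁ S₂ A₂ : Set Ordinal.{u},
      S₁ ⊆ CubGames.limits κ → A₁ ⊆ CubGames.limits κ →
      S₂ ⊆ CubGames.limits κ → A₂ ⊆ CubGames.limits κ →
      CubGames.LamStationary κ ℵ₀ (A₂ \ A₁) →
        ¬ CubGames.BorelReducible κ
          (CubGames.prodRel (CubGames.ES κ S₁) (CubGames.ES κ A₁))
          (CubGames.ES κ (S₂ ∪ A₂)) ∧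
        ∀ α₁ < κ.ord, ∀ α₂ < κ.ord, ∀ (p₁ : Set.Iio α₁ → Bool) (p₂ : Set.Iio α₂ → Bool)
          (C : Set (CubGames.Cantor κ × CubGames.Cantor κ)),
          C ⊆ CubGames.cyl κ p₁ ×ˢ CubGames.cyl κ p₂ →
          CubGames.ComeagerIn κ (CubGames.cyl κ p₁ ×ˢ CubGames.cyl κ p₂) C →
          ¬ CubGames.ContinuouslyReducibleOn C
            (CubGames.prodRel (CubGames.ES κ S₁) (CubGames.ES κ A₁))
            (CubGames.ES κ (S₂ ∪ A₂))) := by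
  open CubGames in
  have hκ' : ℵ₀ < κ := lt_of_le_of_lt hlam.1.aleph0_le hlam.2
  have hω : ∀ {X Y : Set Ordinal.{u}}, X ⊆ cofEq κ ℵ₀ → Stationary κ (X \ Y) →
      LamStationary κ ℵ₀ (X \ Y) := fun hX h =>
    h.lamStationary hκ hκ' isRegular_aleph0 (sdiff_subset.trans hX)
  refine ⟨fun S₁ S₂ h₁ _ hst => ?_, fun _ μ _ _ hμ Csq hC S Bnr hS _ hBnr S₁ S₂ B h₁ _ hB hst => ?_,
    fun S₁ S₂ A₁ A₂ hS₁ hS₂ hA₁ hA₂ hst => ?_, fun S₁ S₂ A₂ hS₁ _ _ hA hS => ?_,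
    fun S₁ A₁ S₂ A₂ hS₁ hA₁ _ _ hst => ?_⟩
  · exact not_reducible_single hκ hκκ fun ρ =>
      ρ.false_of_gcCharacterization hκ hκ' hlam hGC h₁ fun _ => hst
  · exact not_reducible_single hκ hκκ
      (PairReduction.false_of_isSquareSeq hκ hκ' hμ hC hS hBnr h₁ hB hst)
  · have hS0 := zero_notMem_of_subset_cofEq isRegular_aleph0 hS₁
    have hA0 := zero_notMem_of_subset_cofEq isRegular_aleph0 hA₁
    have := not_reducible_prod hκ (S₁ := S₁) (A₁ := A₁) (E' := prodRel (ES κ S₂) (ES κ A₂))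
      (T := fun c => bif c then A₂ else S₂)
      -- The first alternative freezes the second coordinate and plays with `S₁`; the other one
      -- freezes the first and plays with `A₁`.
      (hst.imp
        (fun h => ⟨hA0, fun ρ => ρ.false_of_lamStationary hκ hκ' hS0 (by
          rintro (_ | _); exacts [hω hS₂ h.1, hω hA₂ h.2])⟩)
        (fun h => ⟨hS0, fun ρ => ρ.false_of_lamStationary hκ hκ' hA0 (by
          rintro (_ | _); exacts [hω hS₂ h.1, hω hA₂ h.2])⟩))
      (fun c y => bif c then y.2 else y.1)
      (by rintro (_ | _); exacts [continuous_fst, continuous_snd])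
      prodRel_iff_forall
      (fun f hf => hf.exists_continuousOn_prod hκ hκκ)
    exact ⟨this.1, fun α hα r₁ r₂ C hC => this.2 α hα α hα r₁ r₂ C _ hC subset_rfl⟩
  · exact not_reducible_single_prod hκ hκκ fun ρ => ρ.false_of_lamStationary hκ hκ'
      (zero_notMem_of_subset_limits hS₁) (by rintro (_ | _); exacts [hS, hA])
  · have := not_reducible_prod hκ (S₁ := S₁) (A₁ := A₁) (E' := ES κ (S₂ ∪ A₂))
      (T := fun _ => S₂ ∪ A₂)
      -- With the first coordinate frozen, only `(S₂ ∪ A₂) \ A₁ ⊇ A₂ \ A₁` matters.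
      (Or.inr ⟨zero_notMem_of_subset_limits hS₁, fun ρ => ρ.false_of_lamStationary hκ hκ'
        (zero_notMem_of_subset_limits hA₁) fun _ =>
          hst.mono (sdiff_subset_sdiff_left subset_union_right)⟩)
      (fun _ => id) (fun _ => continuous_id) (fun y y' => ⟨fun h _ => h, fun h => h true⟩)
      (fun f hf => hf.exists_continuousOn hκ hκκ)
    exact ⟨this.1, fun α₁ h₁ α₂ h₂ p₁ p₂ C _ hC =>
      this.2 α₁ h₁ α₂ h₂ p₁ p₂ C C hC inter_subset_left⟩
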